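/- Conventions. A directed graph is a nonempty set $V$ with a binary edge relation $E$ on $V$, i.e. a nonempty structure of the vocabulary $\{E\}$. Formulas of $(\mathrm{FO}+\mathrm{LFP})$ are built from atomic formulas (including atoms $P(\bar t)$ for relation variables $P$) by the first-order constructors and by the following one: if $\varphi(P,\bar a,x_1,\dots,x_r)$ is a formula with parameters $\bar a$ (and possibly further relation variables) in which the $r$-ary relation variable $P$ has only positive occurrences, then $[\mathrm{LFP}_{P;x_1,\dots,x_r}\,\varphi](t_1,\dots,t_r)$ is a formula. In a finite structure $M$, for given values of the parameters, let $P_0=\emptyset$ and $P_{k+1}=\{\bar x : M\models\varphi(P_k,\bar a,\bar x)\}$; the formula says that $(t_1,\dots,t_r)\in\bigcup_k P_k$. A formula of $(\mathrm{FO}+\mathrm{LFP})$ over $\{E\}$ may have free individual variables but has no free relation variables. Theorem. There is a sequence $G_1,G_2,\dots$ of finite directed graphs such that the class $\mathcal G$ of all directed graphs isomorphic to some $G_j$ has the following two properties. 1. $\mathcal G$ admits positive elementary inductions (fixed points) of unbounded depth: there is a first-order formula $\varphi(P,\bar a,\bar x)$ of vocabulary $\{E,P\}$, with only positive occurrences of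 the relation symbol $P$, whose arity is the length of $\bar x$, such that for every $j$ there are a graph $M\in\mathcal G$ and values in $M$ of the parameters $\bar a$ for which $P_j\neq\bigcup_k P_k$. 2. Every $(\mathrm{FO}+\mathrm{LFP})$ formula $\varphi(y_1,\dots,y_n)$ over $\{E\}$, $n\ge 0$, is equivalent in $\mathcal G$ to a first-order formula: there is a first-order formula $\psi(y_1,\dots,y_n)$ over $\{E\}$ such that $M\models\varphi(\bar b)\Leftrightarrow M\models\psi(\bar b)$ for all $M\in\mathcal G$ and all $\bar b\in M^n$. So, for classes $K$ of finite structures closed under isomorphism, the condition "every $(\mathrm{FO}+\mathrm{LFP})$ formula is equivalent to a first-order formula in $K$" (M2) does not imply "every positive elementary induction is bounded in $K$" (M1), which refutes McColm's conjecture. -/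

import Mathlib

/-!
First-order logic with the least fixed point operator, (FO + LFP), on finite structures.
First-order formulas, structures and isomorphisms are those of `FirstOrder.Language`.
-/

universe u v

namespace McColm

open scoped FirstOrder

/-- Formulas of first-order logic with relation variables and fixed point operators, over the
vocabulary `L`. `Γ` is the list of the arities of the relation variables in scope, and the
individual variables in scope are indexed by `Fin n`. Disjunction, implication and the universal
quantifier are the usual abbreviations.

In `lfp r φ ts`, the formula `φ` has a new relation variable `P` of arity `r` (number `0` in the
list) and `r` new individual variables (the last `r` of the `n + r` ones), and
`lfp r φ ts` is `[LFP_{P; x_1, …, x_r} φ] (t_1, …, t_r)`. The first `n` variables of `φ` and the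
other relation variables are parameters. -/
inductive Fml (L : FirstOrder.Language.{u, v}) : List ℕ → ℕ → Type (max u v)
  | equal {Γ : List ℕ} {n : ℕ} (t₁ t₂ : L.Term (Fin n)) : Fml L Γ n
  | rel {Γ : List ℕ} {n k : ℕ} (R : L.Relations k) (ts : Fin k → L.Term (Fin n)) : Fml L Γ n
  | relVar {Γ : List ℕ} {n : ℕ} (i : Fin Γ.length) (ts : Fin (Γ.get i) → L.Term (Fin n)) :
      Fml L Γ n
  | neg {Γ : List ℕ} {n : ℕ} (φ : Fml L Γ n) : Fml L Γ n
  | and {Γ : List ℕ} {n : ℕ} (φ ψ : Fml L Γ n) : Fml L Γ n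
  | ex {Γ : List ℕ} {n : ℕ} (φ : Fml L Γ (n + 1)) : Fml L Γ n
  | lfp {Γ : List ℕ} {n : ℕ} (r : ℕ) (φ : Fml L (r :: Γ) (n + r))
      (ts : Fin r → L.Term (Fin n)) : Fml L Γ n

/-- The values of the relation variables in `Γ`: one relation on `M` for each, of its arity. -/
abbrev RelEnv (M : Type*) (Γ : List ℕ) : Type _ :=
  (i : Fin Γ.length) → Set (Fin (Γ.get i) → M)

/-- Add the value of a new relation variable in front. -/
def RelEnv.cons {M : Type*} {Γ : List ℕ} {r : ℕ} (P : Set (Fin r → M)) (ρ : RelEnv M Γ) :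
    RelEnv M (r :: Γ) :=
  Fin.cons (α := fun i : Fin (Γ.length + 1) => Set (Fin ((r :: Γ).get i) → M)) P ρ

/-- The only environment for the empty list of relation variables. -/
def RelEnv.nil {M : Type*} : RelEnv M [] := fun i => i.elim0

/-- The stage `P_k` of the induction with operator `F`: `P_0 = ∅` and `P_{k+1} = F P_k`. -/
def stage {α : Type*} (F : Set α → Set α) : ℕ → Set α
  | 0 => ∅
  | k + 1 => F (stage F k)

namespace Fml

variable {L : FirstOrder.Language.{u, v}}

/-- Satisfaction. The fixed point is the union of the stages, as usual on finite structures. -/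
def Realize {M : Type*} [L.Structure M] : {Γ : List ℕ} → {n : ℕ} →
    Fml L Γ n → RelEnv M Γ → (Fin n → M) → Prop
  | _, _, equal t₁ t₂, _, a => t₁.realize a = t₂.realize a
  | _, _, rel R ts, _, a => FirstOrder.Language.Structure.RelMap R (fun i => (ts i).realize a)
  | _, _, relVar i ts, ρ, a => (fun l => (ts l).realize a) ∈ ρ i
  | _, _, neg φ, ρ, a => ¬ φ.Realize ρ a
  | _, _, and φ ψ, ρ, a => φ.Realize ρ a ∧ ψ.Realize ρ a
  | _, _, ex φ, ρ, a => ∃ x : M, φ.Realize ρ (Fin.snoc a x)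
  | _, _, lfp r φ ts, ρ, a =>
      (fun l => (ts l).realize a) ∈
        ⋃ k : ℕ, stage (fun P : Set (Fin r → M) =>
          {x | φ.Realize (RelEnv.cons P ρ) (Fin.append a x)}) k

/-- `φ.Polarity b i`: all free occurrences of the relation variable `i` in `φ` are positive
(in the scope of an even number of negations) if `b = true`, and negative if `b = false`. -/
def Polarity : {Γ : List ℕ} → {n : ℕ} → Fml L Γ n → Bool → Fin Γ.length → Prop
  | _, _, equal _ _, _, _ => True
  | _, _, rel _ _, _, _ => True
  | _, _, relVar j _, b, i => j = i → b = true
  | _, _, neg φ, b, i => φ.Polarity (!b) i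
  | _, _, and φ ψ, b, i => φ.Polarity b i ∧ ψ.Polarity b i
  | _, _, ex φ, b, i => φ.Polarity b i
  | _, _, lfp _ φ _, b, i => φ.Polarity b i.succ

/-- The formulas of (FO + LFP): each LFP operator is applied to a formula in which the relation
variable that it binds has only positive occurrences. -/
def IsLFP : {Γ : List ℕ} → {n : ℕ} → Fml L Γ n → Prop
  | _, _, equal _ _ => True
  | _, _, rel _ _ => True
  | _, _, relVar _ _ => True
  | _, _, neg φ => φ.IsLFP
  | _, _, and φ ψ => φ.IsLFP ∧ ψ.IsLFP
  | _, _, ex φ => φ.IsLFP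
  | Γ, _, lfp _ φ _ => φ.Polarity true (0 : Fin (Γ.length + 1)) ∧ φ.IsLFP

/-- The first-order formulas: no LFP operator occurs. -/
def IsFO : {Γ : List ℕ} → {n : ℕ} → Fml L Γ n → Prop
  | _, _, equal _ _ => True
  | _, _, rel _ _ => True
  | _, _, relVar _ _ => True
  | _, _, neg φ => φ.IsFO
  | _, _, and φ ψ => φ.IsFO ∧ ψ.IsFO
  | _, _, ex φ => φ.IsFO
  | _, _, lfp _ _ _ => False

/-- The operator `P ↦ {x | M ⊨ φ(P, a, x)}` that `φ(P, a, x)` with parameters `a` defines. -/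
def operator {M : Type*} [L.Structure M] {s r : ℕ} (φ : Fml L [r] (s + r)) (a : Fin s → M) :
    Set (Fin r → M) → Set (Fin r → M) :=
  fun P => {x | φ.Realize (RelEnv.cons P RelEnv.nil) (Fin.append a x)}

end Fml

/-- Finite nonempty structures of vocabulary `L`. -/
structure FinStructure (L : FirstOrder.Language.{u, v}) where
  carrier : Type
  str : L.Structure carrier
  fin : Finite carrier
  nonempty : Nonempty carrier

instance (L : FirstOrder.Language.{u, v}) (M : FinStructure L) : L.Structure M.carrier := M.str

instance (L : FirstOrder.Language.{u, v}) (M : FinStructure L) : Finite M.carrier := M.fin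

instance (L : FirstOrder.Language.{u, v}) (M : FinStructure L) : Nonempty M.carrier := M.nonempty

/-- The closure under isomorphism of the set of the structures `G 0, G 1, …`. -/
def isoClass {L : FirstOrder.Language.{u, v}} (G : ℕ → FinStructure L) : Set (FinStructure L) :=
  {M | ∃ j, Nonempty (M.carrier ≃[L] (G j).carrier)}

/-- M1: every positive elementary induction is bounded in `K`. That is, for every first-order
formula `φ(P, a, x)` with only positive occurrences of `P` there is a `j` such that the induction
is complete at stage `j`, in every structure of `K` and for all values of the parameters. -/
def InductionsBounded {L : FirstOrder.Language.{u, v}} (K : Set (FinStructure L)) : Prop :=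
  ∀ (s r : ℕ) (φ : Fml L [r] (s + r)),
    φ.IsFO → φ.Polarity true (0 : Fin 1) →
    ∃ j : ℕ, ∀ M ∈ K, ∀ a : Fin s → M.carrier,
      stage (φ.operator a) j = ⋃ k : ℕ, stage (φ.operator a) k

/-- M2: every (FO + LFP) formula is equivalent to a first-order formula in `K`. -/
def LFPCollapsesToFO {L : FirstOrder.Language.{u, v}} (K : Set (FinStructure L)) : Prop :=
  ∀ (n : ℕ) (φ : Fml L [] n), φ.IsLFP →
    ∃ ψ : L.Formula (Fin n), ∀ M ∈ K, ∀ a : Fin n → M.carrier,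
      φ.Realize RelEnv.nil a ↔ ψ.Realize a

/-- Finite directed graphs: finite structures with one binary relation. -/
abbrev FinDigraph : Type 1 := FinStructure FirstOrder.Language.graph

end McColm

/-! The digraph number `N` consists of a chain of `N + 1` looped elements, the colours, and of
loopless vertices, each with one edge into the chain, to its colour. The vertices are split into
parts `0, …, N`. All formulas are enumerated as `φ 0, φ 1, …`, and part `i` records which tuples
satisfy `φ i`, in such a way that first-order logic can read the record but `φ i` itself cannot;
otherwise the definition would be circular.

The edges inside a part come from a pseudo-random relation, restricted to linked labels. Ordinary
vertices of part `j` have an index below `T j` and any colour. For each recorded tuple `u` of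
colours there are special vertices with indices `p < 2 * T j` and colours `u p`. Two special
vertices can be joined only if they belong to the same tuple, and then only towards the larger
index; any other two vertices of the part can be joined only if their indices differ modulo `T j`. A
transitive tournament with `2 * T j` vertices has to use every index once, and an ordinary vertex of
index `p` would clash with the vertex of index `p + T j`. So the longest tournaments consist of
special vertices, and their colours spell a recorded tuple (`Tour.exists_record`). On the other
hand, in a game with at most `T j` pebbles a residue modulo `T j` is always free when a vertex is to
be placed, so ordinary vertices can imitate all others (`Alike.exists_snoc`), and the record is
invisible.

Formulas with fixed points are invariant under this game, because the stages of an induction are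
(`PebbleSystem.realize_iff`). As `T i` bounds the width of `φ i`, the truth of `φ i` depends only on
the records of the parts before `i`. Hence the records can be defined by recursion
(`partialRecord`), and a tuple satisfies `φ i` if and only if its code, which determines its
position in the game, is recorded in part `i` (`realize_iff_record`). Finding a longest tournament
that spells this code is a first-order matter (`Fast.definable`). All this holds for large `N`; the
finitely many other digraphs are described up to isomorphism (`definable_of_eventually`). The
induction that climbs the chain has unbounded depth (`stage_chainFml`). -/

namespace McColm

open FirstOrder FirstOrder.Language FirstOrder.Language.Structure

/-! ### Pebble games and the invariance of formulas with fixed points. -/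

section Invariance

variable {L : FirstOrder.Language.{u, v}}

/-- A back-and-forth system for the pebble game with `K` pebbles between `M` and `M'`. -/
structure PebbleSystem (L : FirstOrder.Language.{u, v}) (M M' : Type*) [L.Structure M]
    [L.Structure M'] (K : ℕ) where
  rel : ∀ {n : ℕ}, (Fin n → M) → (Fin n → M') → Prop
  reindex : ∀ {m n : ℕ} {a : Fin n → M} {b : Fin n → M'}, rel a b →
    ∀ f : Fin m → Fin n, rel (a ∘ f) (b ∘ f)
  eq_iff : ∀ {n : ℕ} {a : Fin n → M} {b : Fin n → M'}, rel a b → ∀ i j, a i = a j ↔ b i = b j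
  relMap_iff : ∀ {n : ℕ} {a : Fin n → M} {b : Fin n → M'}, rel a b →
    ∀ {k : ℕ} (R : L.Relations k) (f : Fin k → Fin n), RelMap R (a ∘ f) ↔ RelMap R (b ∘ f)
  forth : ∀ {n : ℕ} {a : Fin n → M} {b : Fin n → M'}, n + 1 ≤ K → rel a b →
    ∀ x, ∃ y, rel (Fin.snoc a x : Fin (n + 1) → M) (Fin.snoc b y : Fin (n + 1) → M')
  back : ∀ {n : ℕ} {a : Fin n → M} {b : Fin n → M'}, n + 1 ≤ K → rel a b →
    ∀ y, ∃ x, rel (Fin.snoc a x : Fin (n + 1) → M) (Fin.snoc b y : Fin (n + 1) → M')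

/-- The largest number of individual variables in the scope of a quantifier in a formula. -/
def Fml.width : {Γ : List ℕ} → {n : ℕ} → Fml L Γ n → ℕ
  | _, _, .equal _ _ => 0
  | _, _, .rel _ _ => 0
  | _, _, .relVar _ _ => 0
  | _, _, .neg φ => φ.width
  | _, _, .and φ ψ => max φ.width ψ.width
  | _, n, .ex φ => max (n + 1) φ.width
  | _, _, .lfp _ φ _ => φ.width

/-- In a relational language every term is a variable. -/
def termVar [L.IsRelational] {α : Type*} : L.Term α → α
  | .var x => x
  | .func f _ => isEmptyElim f

theorem realize_eq_termVar [L.IsRelational] {α M : Type*} [L.Structure M] (t : L.Term α)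
    (a : α → M) : t.realize a = a (termVar t) := by
  cases t with
  | var x => rfl
  | func f _ => exact isEmptyElim f

theorem realize_terms_eq [L.IsRelational] {α M : Type*} [L.Structure M] {k : ℕ}
    (ts : Fin k → L.Term α) (a : α → M) :
    (fun l => (ts l).realize a) = a ∘ fun l => termVar (ts l) :=
  funext fun l => realize_eq_termVar (ts l) a

theorem comp_append {α β : Type*} {m n : ℕ} (g : α → β) (e : Fin m → α) (f : Fin n → α) :
    g ∘ Fin.append e f = Fin.append (g ∘ e) (g ∘ f) := by
  ext i
  refine Fin.addCases (fun j => ?_) (fun j => ?_) i <;> simp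

namespace PebbleSystem

variable {M M' : Type*} [L.Structure M] [L.Structure M'] {K : ℕ} (S : PebbleSystem L M M' K)

/-- Environments that correspond to each other, relative to related values of the individual
variables: the value of each relation variable is invariant over some of these variables. -/
def EnvRel {Γ : List ℕ} {n : ℕ} (ρ : RelEnv M Γ) (ρ' : RelEnv M' Γ) (a : Fin n → M)
    (b : Fin n → M') : Prop :=
  ∀ i, ∃ (p : ℕ) (e : Fin p → Fin n), ∀ u w,
    S.rel (Fin.append (a ∘ e) u) (Fin.append (b ∘ e) w) → (u ∈ ρ i ↔ w ∈ ρ' i)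

variable {S}

theorem EnvRel.extend {Γ : List ℕ} {n m : ℕ} {ρ : RelEnv M Γ} {ρ' : RelEnv M' Γ} {a : Fin n → M}
    {b : Fin n → M'} (h : S.EnvRel ρ ρ' a b) {a' : Fin m → M} {b' : Fin m → M'}
    (f : Fin n → Fin m) (ha : a' ∘ f = a) (hb : b' ∘ f = b) : S.EnvRel ρ ρ' a' b' := by
  intro i
  obtain ⟨p, e, he⟩ := h i
  refine ⟨p, f ∘ e, ?_⟩
  rw [← Function.comp_assoc, ← Function.comp_assoc, ha, hb]
  exact he

theorem EnvRel.cons {Γ : List ℕ} {n r : ℕ} {ρ : RelEnv M Γ} {ρ' : RelEnv M' Γ} {a : Fin n → M}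
    {b : Fin n → M'} (h : S.EnvRel ρ ρ' a b) {P : Set (Fin r → M)} {P' : Set (Fin r → M')}
    (hP : ∀ u w, S.rel (Fin.append a u) (Fin.append b w) → (u ∈ P ↔ w ∈ P')) :
    S.EnvRel (RelEnv.cons P ρ) (RelEnv.cons P' ρ') a b := by
  intro i
  refine Fin.cases ?_ (fun j => ?_) i
  · exact ⟨n, id, hP⟩
  · exact h j

variable (S)

/-- Formulas of small width are invariant under a pebble system. -/
theorem realize_iff [L.IsRelational] {Γ : List ℕ} {n : ℕ} (φ : Fml L Γ n) (hφ : φ.width ≤ K) :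
    ∀ (ρ : RelEnv M Γ) (ρ' : RelEnv M' Γ) (a : Fin n → M) (b : Fin n → M'), S.rel a b →
      S.EnvRel ρ ρ' a b → (φ.Realize ρ a ↔ φ.Realize ρ' b) := by
  induction φ with
  | equal t₁ t₂ =>
    intro ρ ρ' a b hab _
    simp only [Fml.Realize, realize_eq_termVar]
    exact S.eq_iff hab _ _
  | rel R ts =>
    intro ρ ρ' a b hab _
    simp only [Fml.Realize, realize_terms_eq]
    exact S.relMap_iff hab R _
  | relVar i ts =>
    intro ρ ρ' a b hab hρ
    simp only [Fml.Realize, realize_terms_eq]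
    obtain ⟨p, e, he⟩ := hρ i
    refine he _ _ ?_
    -- The parameters followed by the arguments only repeat entries of `a`. So reindexing relates
    -- these tuples, even when they are longer than `K`.
    have := S.reindex hab (Fin.append e fun l => termVar (ts l))
    simpa only [comp_append, Function.comp_id] using this
  | neg φ ih =>
    intro ρ ρ' a b hab hρ
    simp only [Fml.Realize]
    exact not_congr (ih hφ ρ ρ' a b hab hρ)
  | and φ ψ ihφ ihψ =>
    intro ρ ρ' a b hab hρ
    simp only [Fml.Realize]
    simp only [Fml.width, max_le_iff] at hφ
    exact and_congr (ihφ hφ.1 ρ ρ' a b hab hρ) (ihψ hφ.2 ρ ρ' a b hab hρ)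
  | ex φ ih =>
    intro ρ ρ' a b hab hρ
    simp only [Fml.Realize]
    simp only [Fml.width, max_le_iff] at hφ
    have key : ∀ x y, S.rel (Fin.snoc a x : Fin _ → M) (Fin.snoc b y : Fin _ → M') →
        (φ.Realize ρ (Fin.snoc a x) ↔ φ.Realize ρ' (Fin.snoc b y)) := fun x y h =>
      ih hφ.2 ρ ρ' _ _ h (hρ.extend Fin.castSucc
        (funext fun i => by simp) (funext fun i => by simp))
    constructor
    · rintro ⟨x, hx⟩
      obtain ⟨y, hy⟩ := S.forth hφ.1 hab x
      exact ⟨y, (key x y hy).1 hx⟩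
    · rintro ⟨y, hy⟩
      obtain ⟨x, hx⟩ := S.back hφ.1 hab y
      exact ⟨x, (key x y hx).2 hy⟩
  | lfp r φ ts ih =>
    intro ρ ρ' a b hab hρ
    simp only [Fml.Realize, realize_terms_eq, Set.mem_iUnion]
    refine exists_congr fun k => ?_
    -- Corresponding stages are invariant over the parameters `a` and `b`; this is what `EnvRel`
    -- asks of the new relation variable at the next stage.
    have key : ∀ k u w, S.rel (Fin.append a u) (Fin.append b w) →
        (u ∈ stage (fun P => {x | φ.Realize (RelEnv.cons P ρ) (Fin.append a x)}) k ↔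
          w ∈ stage (fun P => {x | φ.Realize (RelEnv.cons P ρ') (Fin.append b x)}) k) := by
      intro k
      induction k with
      | zero => intro u w _; simp [stage]
      | succ k ihk =>
        intro u w h
        refine ih hφ _ _ _ _ h ?_
        exact (hρ.cons ihk).extend (Fin.castAdd r)
          (funext fun i => by simp) (funext fun i => by simp)
    refine key k _ _ ?_
    have := S.reindex hab (Fin.append id fun l => termVar (ts l))
    simpa only [comp_append, Function.comp_id] using this

end PebbleSystem

/-- An isomorphism is a pebble system for every number of pebbles. -/
def PebbleSystem.ofEquiv {M M' : Type*} [L.Structure M] [L.Structure M'] (f : M ≃[L] M') (K : ℕ) :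
    PebbleSystem L M M' K where
  rel a b := ∀ i, f (a i) = b i
  reindex h g i := h (g i)
  eq_iff h i j := by rw [← h, ← h, f.injective.eq_iff]
  relMap_iff {n a b} h k R g := by
    rw [← f.map_rel R]
    exact iff_of_eq (congrArg _ (funext fun i => h (g i)))
  forth _ h x := ⟨f x, fun i => by
    refine Fin.lastCases ?_ (fun j => ?_) i
    · simp
    · simp [h]⟩
  back _ h y := ⟨f.symm y, fun i => by
    refine Fin.lastCases ?_ (fun j => ?_) i
    · simp
    · simp [h]⟩

theorem Fml.realize_equiv [L.IsRelational] {M M' : Type*} [L.Structure M] [L.Structure M']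
    (f : M ≃[L] M') {n : ℕ} (φ : Fml L [] n) (a : Fin n → M) :
    φ.Realize RelEnv.nil a ↔ φ.Realize RelEnv.nil (f ∘ a) :=
  (PebbleSystem.ofEquiv f φ.width).realize_iff φ le_rfl _ _ _ _ (fun _ => rfl) fun i => i.elim0

end Invariance

/-! ### Countability of the set of formulas. -/

section Countability

variable {L : FirstOrder.Language.{u, v}}

/-- A numbering of the formulas over a countable vocabulary. -/
noncomputable def Fml.number [∀ n, Countable (L.Term (Fin n))] [∀ n, Countable (L.Relations n)] :
    {Γ : List ℕ} → {n : ℕ} → Fml L Γ n → ℕ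
  | _, n, .equal t₁ t₂ =>
      Nat.pair 0 (Nat.pair ((exists_injective_nat (L.Term (Fin n))).choose t₁)
        ((exists_injective_nat (L.Term (Fin n))).choose t₂))
  | _, n, .rel (k := k) R ts =>
      Nat.pair 1 (Nat.pair k (Nat.pair ((exists_injective_nat (L.Relations k)).choose R)
        ((exists_injective_nat (Fin k → L.Term (Fin n))).choose ts)))
  | Γ, n, .relVar i ts =>
      Nat.pair 2 (Nat.pair i
        ((exists_injective_nat (Fin (Γ.get i) → L.Term (Fin n))).choose ts))
  | _, _, .neg φ => Nat.pair 3 φ.number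
  | _, _, .and φ ψ => Nat.pair 4 (Nat.pair φ.number ψ.number)
  | _, _, .ex φ => Nat.pair 5 φ.number
  | _, n, .lfp r φ ts =>
      Nat.pair 6 (Nat.pair r (Nat.pair φ.number
        ((exists_injective_nat (Fin r → L.Term (Fin n))).choose ts)))

theorem Fml.number_injective [∀ n, Countable (L.Term (Fin n))] [∀ n, Countable (L.Relations n)]
    {Γ : List ℕ} {n : ℕ} : Function.Injective (Fml.number : Fml L Γ n → ℕ) := by
  intro φ
  induction φ with
  | @equal Γ n t₁ t₂ =>
    intro ψ h
    cases ψ <;> simp only [Fml.number, Nat.pair_eq_pair] at h <;> try omega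
    obtain ⟨-, h₁, h₂⟩ := h
    rw [(exists_injective_nat (L.Term (Fin n))).choose_spec h₁,
      (exists_injective_nat (L.Term (Fin n))).choose_spec h₂]
  | @rel Γ n k R ts =>
    intro ψ h
    cases ψ <;> simp only [Fml.number, Nat.pair_eq_pair] at h <;> try omega
    obtain ⟨-, rfl, h₁, h₂⟩ := h
    rw [(exists_injective_nat (L.Relations k)).choose_spec h₁,
      (exists_injective_nat (Fin k → L.Term (Fin n))).choose_spec h₂]
  | @relVar Γ n i ts =>
    intro ψ h
    cases ψ <;> simp only [Fml.number, Nat.pair_eq_pair] at h <;> try omega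
    obtain ⟨-, h₁, h₂⟩ := h
    obtain rfl := Fin.ext h₁
    rw [(exists_injective_nat (Fin (Γ.get i) → L.Term (Fin n))).choose_spec h₂]
  | neg φ ih =>
    intro ψ h
    cases ψ <;> simp only [Fml.number, Nat.pair_eq_pair] at h <;> try omega
    rw [ih h.2]
  | and φ ψ ihφ ihψ =>
    intro χ h
    cases χ <;> simp only [Fml.number, Nat.pair_eq_pair] at h <;> try omega
    rw [ihφ h.2.1, ihψ h.2.2]
  | ex φ ih =>
    intro ψ h
    cases ψ <;> simp only [Fml.number, Nat.pair_eq_pair] at h <;> try omega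
    rw [ih h.2]
  | @lfp Γ n r φ ts ih =>
    intro ψ h
    cases ψ <;> simp only [Fml.number, Nat.pair_eq_pair] at h <;> try omega
    obtain ⟨-, rfl, h₁, h₂⟩ := h
    rw [ih h₁, (exists_injective_nat (Fin r → L.Term (Fin n))).choose_spec h₂]

instance Fml.countable [∀ n, Countable (L.Term (Fin n))] [∀ n, Countable (L.Relations n)]
    {Γ : List ℕ} {n : ℕ} : Countable (Fml L Γ n) :=
  Fml.number_injective.countable

instance countable_graph_relations (n : ℕ) : Countable (Language.graph.Relations n) :=
  inferInstance

instance countable_graph_term (n : ℕ) : Countable (Language.graph.Term (Fin n)) :=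
  inferInstance

end Countability

/-! ### Closure properties of uniform first-order definability. -/

section Definability

variable {L : FirstOrder.Language.{u, v}} {ι : Type*} (G : ι → Type*) [∀ i, L.Structure (G i)]

variable (L) in
/-- A family of relations on the structures `G i` is defined by one first-order formula. -/
def Def {α : Type} (R : ∀ i, (α → G i) → Prop) : Prop :=
  ∃ ψ : L.Formula α, ∀ i a, R i a ↔ ψ.Realize a

variable {G} {α β : Type}

namespace Def

theorem congr {R R' : ∀ i, (α → G i) → Prop} (h : Def L G R) (hR : ∀ i a, R' i a ↔ R i a) :
    Def L G R' :=
  h.imp fun _ hψ i a => (hR i a).trans (hψ i a)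

theorem eq (x y : α) : Def L G fun i (a : α → G i) => a x = a y :=
  ⟨(Term.var x).equal (Term.var y), fun i a => by simp [Formula.realize_equal]⟩

theorem not {R : ∀ i, (α → G i) → Prop} (h : Def L G R) : Def L G fun i a => ¬ R i a := by
  obtain ⟨ψ, hψ⟩ := h
  exact ⟨ψ.not, fun i a => (Formula.realize_not.trans (not_congr (hψ i a).symm)).symm⟩

theorem and {R R' : ∀ i, (α → G i) → Prop} (h : Def L G R) (h' : Def L G R') :
    Def L G fun i a => R i a ∧ R' i a := by
  obtain ⟨ψ, hψ⟩ := h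
  obtain ⟨ψ', hψ'⟩ := h'
  exact ⟨ψ ⊓ ψ', fun i a =>
    (Formula.realize_inf.trans (and_congr (hψ i a).symm (hψ' i a).symm)).symm⟩

theorem or {R R' : ∀ i, (α → G i) → Prop} (h : Def L G R) (h' : Def L G R') :
    Def L G fun i a => R i a ∨ R' i a :=
  (h.not.and h'.not).not.congr fun i a => by tauto

theorem imp {R R' : ∀ i, (α → G i) → Prop} (h : Def L G R) (h' : Def L G R') :
    Def L G fun i a => R i a → R' i a :=
  (h.not.or h').congr fun i a => by tauto

theorem forall_finite [Finite β] {R : β → ∀ i, (α → G i) → Prop} (h : ∀ b, Def L G (R b)) :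
    Def L G fun i a => ∀ b, R b i a := by
  choose ψ hψ using h
  exact ⟨Formula.iInf ψ, fun i a => by simp only [Formula.realize_iInf, hψ]⟩

theorem exists_finite [Finite β] {R : β → ∀ i, (α → G i) → Prop} (h : ∀ b, Def L G (R b)) :
    Def L G fun i a => ∃ b, R b i a := by
  choose ψ hψ using h
  exact ⟨Formula.iSup ψ, fun i a => by simp only [Formula.realize_iSup, hψ]⟩

theorem const (p : Prop) : Def L G fun i (_ : α → G i) => p := by
  by_cases hp : p
  · exact ⟨⊤, fun i a => by simp [hp]⟩
  · exact ⟨⊥, fun i a => by simp [hp]⟩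

theorem exists_tuple [Finite β] {R : ∀ i, (α → G i) → (β → G i) → Prop}
    (h : Def L G fun i (a : α ⊕ β → G i) => R i (fun x => a (.inl x)) fun y => a (.inr y)) :
    Def L G fun i a => ∃ b, R i a b := by
  obtain ⟨ψ, hψ⟩ := h
  refine ⟨ψ.iExs β, fun i a => ?_⟩
  rw [Formula.realize_iExs]
  exact exists_congr fun b => hψ i (Sum.elim a b)

theorem exists_elem {R : ∀ i, (α → G i) → G i → Prop}
    (h : Def L G fun i (a : α ⊕ Unit → G i) => R i (fun x => a (.inl x)) (a (.inr ()))) :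
    Def L G fun i a => ∃ b, R i a b :=
  (exists_tuple (R := fun i a b => R i a (b ())) h).congr fun _ _ =>
    ⟨fun ⟨b, hb⟩ => ⟨fun _ => b, hb⟩, fun ⟨b, hb⟩ => ⟨b (), hb⟩⟩

theorem forall_tuple [Finite β] {R : ∀ i, (α → G i) → (β → G i) → Prop}
    (h : Def L G fun i (a : α ⊕ β → G i) => R i (fun x => a (.inl x)) fun y => a (.inr y)) :
    Def L G fun i a => ∀ b, R i a b :=
  (exists_tuple (R := fun i a b => ¬ R i a b) h.not).not.congr fun _ _ => by push Not; rfl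

theorem forall_elem {R : ∀ i, (α → G i) → G i → Prop}
    (h : Def L G fun i (a : α ⊕ Unit → G i) => R i (fun x => a (.inl x)) (a (.inr ()))) :
    Def L G fun i a => ∀ b, R i a b :=
  (exists_elem (R := fun i a b => ¬ R i a b) h.not).not.congr fun _ _ => by push Not; rfl

end Def

end Definability

/-! ### Digraphs, and the elimination of finitely many exceptional structures. -/

section Digraphs

/-- The edge relation of a digraph. -/
def Edge {M : Type*} [Language.graph.Structure M] (x y : M) : Prop := RelMap adj ![x, y]

theorem relMap_graph_iff {M : Type*} [Language.graph.Structure M] {k : ℕ}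
    (R : Language.graph.Relations k) {m : ℕ} {M' : Type*} [Language.graph.Structure M']
    (f : Fin k → Fin m) (a : Fin m → M) (b : Fin m → M')
    (h : ∀ i j, Edge (a i) (a j) ↔ Edge (b i) (b j)) : RelMap R (a ∘ f) ↔ RelMap R (b ∘ f) := by
  cases R
  have ha : a ∘ f = ![a (f 0), a (f 1)] := by ext i; fin_cases i <;> rfl
  have hb : b ∘ f = ![b (f 0), b (f 1)] := by ext i; fin_cases i <;> rfl
  rw [ha, hb]
  exact h _ _

theorem Def.edge {ι : Type*} {G : ι → Type*} [∀ i, Language.graph.Structure (G i)] {α : Type}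
    (x y : α) : Def Language.graph G fun i (a : α → G i) => Edge (a x) (a y) := by
  refine ⟨adj.formula₂ (Term.var x) (Term.var y), fun i a => ?_⟩
  rw [Formula.realize_rel₂]
  rfl

/-- `y` is the image of `a` under an isomorphism from `A` onto `M`. -/
def IsCopy {A M : Type*} [Language.graph.Structure A] [Language.graph.Structure M] {n : ℕ}
    (a : Fin n → A) (y : Fin n → M) : Prop :=
  ∃ f : A ≃[Language.graph] M, f ∘ a = y

/-- For finite `A` an isomorphism is a tuple of elements of `M` indexed by `A`, which first-order
quantifiers can range over. -/
theorem isCopy_iff {A M : Type*} [Language.graph.Structure A] [Language.graph.Structure M] {n : ℕ}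
    (a : Fin n → A) (y : Fin n → M) :
    IsCopy a y ↔ ∃ x : A → M, (∀ p : A × A, (x p.1 = x p.2 → p.1 = p.2) ∧
      (Edge (x p.1) (x p.2) ↔ Edge p.1 p.2)) ∧ (∀ z, ∃ c, z = x c) ∧ ∀ s, x (a s) = y s := by
  constructor
  · rintro ⟨f, rfl⟩
    refine ⟨f, fun p => ⟨fun h => f.injective h, ?_⟩, fun z => ⟨f.symm z, by simp⟩, fun s => rfl⟩
    have := f.map_rel adj ![p.1, p.2]
    rw [Edge, Edge, ← this]
    exact iff_of_eq (congrArg _ (by ext i; fin_cases i <;> rfl))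
  · rintro ⟨x, hx, hs, hy⟩
    let e : A ≃ M := Equiv.ofBijective x ⟨fun p q h => (hx (p, q)).1 h, fun z =>
      (hs z).imp fun _ h => h.symm⟩
    refine ⟨⟨e, fun f => isEmptyElim f, fun {k} R v => ?_⟩, funext hy⟩
    cases R
    have hv : v = ![v 0, v 1] := by ext i; fin_cases i <;> rfl
    have hev : e.toFun ∘ v = ![x (v 0), x (v 1)] := by ext i; fin_cases i <;> rfl
    rw [hev, hv]
    exact (hx (v 0, v 1)).2

theorem Def.isCopy {ι : Type*} {G : ι → Type*} [∀ i, Language.graph.Structure (G i)]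
    {A : Type} [Finite A] [Language.graph.Structure A] {n : ℕ} (a : Fin n → A) :
    Def Language.graph G fun _ y => IsCopy a y := by
  simp only [isCopy_iff]
  refine Def.exists_tuple (.and (.forall_finite fun p => .and (.imp (.eq _ _) (.const _)) ?_)
    (.and (.forall_elem (.exists_finite fun c => .eq _ _)) (.forall_finite fun s => .eq _ _)))
  exact ((Def.edge _ _).imp (.const _)).and ((Def.const _).imp (.edge _ _)) |>.congr
    fun _ _ => iff_iff_implies_and_implies

/-- Finitely many structures do not matter for the definability of a formula. -/
theorem definable_of_eventually (G : ℕ → FinDigraph) {n : ℕ} (φ : Fml Language.graph [] n)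
    (N₀ : ℕ) (h : Def Language.graph (fun N : {N // N₀ ≤ N} => (G N).carrier)
      fun _ a => φ.Realize RelEnv.nil a) :
    Def Language.graph (fun N => (G N).carrier) fun _ a => φ.Realize RelEnv.nil a := by
  obtain ⟨ψ, hψ⟩ := h
  have h₁ : Def Language.graph (fun N => (G N).carrier) fun _ y =>
      ∃ N : Fin N₀, ∃ a : Fin n → (G N).carrier, φ.Realize RelEnv.nil a ∧ IsCopy a y :=
    .exists_finite fun N => .exists_finite fun a => .and (.const _) (.isCopy a)
  have h₂ : Def Language.graph (fun N => (G N).carrier) fun _ y =>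
      ∃ N : Fin N₀, ∃ a : Fin n → (G N).carrier, IsCopy a y :=
    .exists_finite fun N => .exists_finite fun a => .isCopy a
  have h₃ : Def Language.graph (fun N => (G N).carrier) fun _ y => ψ.Realize y :=
    ⟨ψ, fun _ _ => Iff.rfl⟩
  -- A copy of one of the first `N₀` structures is treated by listing the satisfying tuples up to
  -- isomorphism; any other structure is treated by `ψ`.
  refine (h₁.or (h₂.not.and h₃)).congr fun N y => ?_
  constructor
  · intro hy
    by_cases hN : ∃ N : Fin N₀, ∃ a : Fin n → (G N).carrier, IsCopy a y
    · obtain ⟨N', a, f, rfl⟩ := hN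
      exact .inl ⟨N', a, (φ.realize_equiv f a).2 hy, f, rfl⟩
    · refine .inr ⟨hN, (hψ ⟨N, ?_⟩ y).1 hy⟩
      by_contra hlt
      exact hN ⟨⟨N, not_le.1 hlt⟩, y, Language.Equiv.refl _ _, rfl⟩
  · rintro (⟨N', a, ha, f, rfl⟩ | ⟨hN, hy⟩)
    · exact (φ.realize_equiv f a).1 ha
    · refine (hψ ⟨N, ?_⟩ y).2 hy
      by_contra hlt
      exact hN ⟨⟨N, not_le.1 hlt⟩, y, Language.Equiv.refl _ _, rfl⟩

end Digraphs

/-! ### Existence of universal relations, by counting. -/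

section Universal

/-- `ω` realizes every pattern over at most `k` points, by points in every class. -/
def IsUniversal {Λ β : Type*} (k : ℕ) (ω : Λ × β → Λ × β → Bool) : Prop :=
  ∀ S : Finset (Λ × β), S.card ≤ k → ∀ (p q : Λ × β → Bool) (l : Λ),
    ∃ b, (l, b) ∉ S ∧ ∀ x ∈ S, ω (l, b) x = p x ∧ ω x (l, b) = q x

variable {Λ β : Type} [DecidableEq Λ] [DecidableEq β]

/-- Overwrite the values of `ω` between the points `(l, b)` outside `S` and the points of `S`. -/
def overwrite (S : Finset (Λ × β)) (l : Λ) (ω : Λ × β → Λ × β → Bool)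
    (h : {b : β // (l, b) ∉ S} → S → Bool × Bool) (x y : Λ × β) : Bool :=
  if hx : x.1 = l ∧ (l, x.2) ∉ S ∧ y ∈ S then (h ⟨x.2, hx.2.1⟩ ⟨y, hx.2.2⟩).1
  else if hy : y.1 = l ∧ (l, y.2) ∉ S ∧ x ∈ S then (h ⟨y.2, hy.2.1⟩ ⟨x, hy.2.2⟩).2
  else ω x y

/-- The values of `ω` between the points `(l, b)` outside `S` and the points of `S`. -/
def entries (S : Finset (Λ × β)) (l : Λ) (ω : Λ × β → Λ × β → Bool)
    (b : {b : β // (l, b) ∉ S}) (x : S) : Bool × Bool :=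
  (ω (l, b) x, ω x (l, b))

/-- With `overwrite_overwrite_entries` this shows that `(ω, h)` can be recovered from the
overwritten relation and the old entries, which makes the map of the counting argument injective. -/
theorem entries_overwrite (S : Finset (Λ × β)) (l : Λ) (ω : Λ × β → Λ × β → Bool)
    (h : {b : β // (l, b) ∉ S} → S → Bool × Bool) : entries S l (overwrite S l ω h) = h := by
  funext b x
  have hx := x.2
  have hb := b.2
  simp [entries, overwrite, hb]

theorem overwrite_overwrite_entries (S : Finset (Λ × β)) (l : Λ) (ω : Λ × β → Λ × β → Bool)
    (h : {b : β // (l, b) ∉ S} → S → Bool × Bool) :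
    overwrite S l (overwrite S l ω h) (entries S l ω) = ω := by
  funext x y
  by_cases hx : x.1 = l ∧ (l, x.2) ∉ S ∧ y ∈ S
  · obtain ⟨l', b⟩ := x
    obtain ⟨rfl, hb, hy⟩ := hx
    simp only at hb
    simp [overwrite, entries, hb, hy]
  · by_cases hy : y.1 = l ∧ (l, y.2) ∉ S ∧ x ∈ S
    · rw [overwrite, dif_neg hx, dif_pos hy]
      obtain ⟨l', b⟩ := y
      obtain ⟨rfl, hb, hy⟩ := hy
      simp [entries]
    · rw [overwrite, dif_neg hx, dif_neg hy, overwrite, dif_neg hx, dif_neg hy]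

variable [Fintype Λ] [Fintype β]

open Classical in
/-- The relations that omit the pattern `(p, q)` over `S` in the class `l`. -/
noncomputable def omitting (S : Finset (Λ × β)) (p q : Λ × β → Bool) (l : Λ) :
    Finset (Λ × β → Λ × β → Bool) :=
  {ω | ∀ b, (l, b) ∉ S → ¬ ∀ x ∈ S, ω (l, b) x = p x ∧ ω x (l, b) = q x}

/-- Each point of the class outside `S` has `4 ^ S.card` possible entries over `S`, and omission of
the pattern forbids one of them. The injection exchanges the entries of `ω` with arbitrary ones `h`:
the old entries avoid the pattern. -/
theorem card_omitting_mul_le (S : Finset (Λ × β)) (p q : Λ × β → Bool) (l : Λ) :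
    (omitting S p q l).card * (4 ^ S.card) ^ Fintype.card {b : β // (l, b) ∉ S} ≤
      Fintype.card (Λ × β → Λ × β → Bool) *
        (4 ^ S.card - 1) ^ Fintype.card {b : β // (l, b) ∉ S} := by
  classical
  let target : S → Bool × Bool := fun x => (p x, q x)
  have h1 : Fintype.card (omitting S p q l × ({b : β // (l, b) ∉ S} → S → Bool × Bool)) =
      (omitting S p q l).card * (4 ^ S.card) ^ Fintype.card {b : β // (l, b) ∉ S} := by
    simp
  have h2 : Fintype.card ((Λ × β → Λ × β → Bool) ×
      ({b : β // (l, b) ∉ S} → {t : S → Bool × Bool // t ≠ target})) =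
      Fintype.card (Λ × β → Λ × β → Bool) *
        (4 ^ S.card - 1) ^ Fintype.card {b : β // (l, b) ∉ S} := by
    rw [Fintype.card_prod, Fintype.card_fun (β := {t : S → Bool × Bool // t ≠ target}),
      Fintype.card_subtype_compl, Fintype.card_subtype_eq]
    simp
  rw [← h1, ← h2]
  refine Fintype.card_le_of_injective (fun z => (overwrite S l z.1 z.2, fun b =>
    ⟨entries S l z.1 b, fun ht => ?_⟩)) ?_
  · have := z.1.2
    simp only [omitting, Finset.mem_filter_univ] at this
    refine this b b.2 fun x hx => ?_
    have := congrFun ht ⟨x, hx⟩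
    simpa [entries, target] using this
  · rintro ⟨⟨ω, hω⟩, h⟩ ⟨⟨ω', hω'⟩, h'⟩ he
    simp only [Prod.mk.injEq] at he
    obtain ⟨he₁, he₂⟩ := he
    have e : entries S l ω = entries S l ω' := by
      funext b
      simpa using congrFun he₂ b
    have hh : h = h' := by
      rw [← entries_overwrite S l ω h, he₁, entries_overwrite]
    have hw : ω = ω' := by
      rw [← overwrite_overwrite_entries S l ω h, he₁, e, overwrite_overwrite_entries]
    subst hh hw
    rfl

/-- At most `k` points of the class lie in `S`, so the exponent is at least `Fintype.card β - k`;
replacing `S.card` by `k` in the base only weakens the bound. -/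
theorem card_omitting_le {k : ℕ} (S : Finset (Λ × β)) (hS : S.card ≤ k) (p q : Λ × β → Bool)
    (l : Λ) : ((omitting S p q l).card : ℝ) ≤
      Fintype.card (Λ × β → Λ × β → Bool) * (1 - (4 ^ k)⁻¹) ^ (Fintype.card β - k) := by
  set m := Fintype.card {b : β // (l, b) ∉ S} with hm
  have hmk : Fintype.card β - k ≤ m := by
    rw [hm, Fintype.card_subtype_compl]
    refine Nat.sub_le_sub_left (le_trans ?_ hS) _
    rw [Fintype.card_subtype]
    refine Finset.card_le_card_of_injOn (fun b => (l, b)) ?_ ?_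
    · intro b hb
      simpa using hb
    · intro b _ b' _ h
      simpa using h
  have h := card_omitting_mul_le S p q l
  rw [← hm] at h
  have h4 : (0 : ℝ) < 4 ^ S.card := by positivity
  have h' : ((omitting S p q l).card : ℝ) * (4 ^ S.card) ^ m ≤
      Fintype.card (Λ × β → Λ × β → Bool) * (4 ^ S.card - 1) ^ m := by
    have h'' : (((omitting S p q l).card * (4 ^ S.card) ^ m : ℕ) : ℝ) ≤
      ((Fintype.card (Λ × β → Λ × β → Bool) * (4 ^ S.card - 1) ^ m : ℕ) : ℝ) := by
      exact_mod_cast h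
    have h5 : ((4 ^ S.card - 1 : ℕ) : ℝ) = 4 ^ S.card - 1 := by
      rw [Nat.cast_sub (Nat.one_le_pow _ _ (by norm_num))]
      simp
    rw [Nat.cast_mul, Nat.cast_mul, Nat.cast_pow, Nat.cast_pow _ m, h5] at h''
    simpa using h''
  have h1 : ((omitting S p q l).card : ℝ) ≤
      Fintype.card (Λ × β → Λ × β → Bool) * (1 - (4 ^ S.card)⁻¹) ^ m := by
    rw [← le_div_iff₀ (by positivity), mul_div_assoc, ← div_pow, sub_div, div_self h4.ne',
      one_div] at h'
    exact h'
  refine h1.trans (mul_le_mul_of_nonneg_left ?_ (by positivity))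
  have hle : (4 ^ k : ℝ)⁻¹ ≤ (4 ^ S.card)⁻¹ := by
    gcongr
    norm_num
  have hle1 : ((4 : ℝ) ^ S.card)⁻¹ ≤ 1 := inv_le_one_of_one_le₀ (one_le_pow₀ (by norm_num))
  calc (1 - ((4 : ℝ) ^ S.card)⁻¹) ^ m ≤ (1 - (4 ^ k)⁻¹) ^ m :=
        pow_le_pow_left₀ (by linarith) (by linarith) _
    _ ≤ _ := pow_le_pow_of_le_one (by linarith) (by
        have : (0 : ℝ) < (4 ^ k)⁻¹ := by positivity
        linarith) hmk

/-- A union bound. Only the values of a pattern on `S` matter, so a possible failure is given by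
`S`, the subsets of `S` where `p` and `q` are true, and the class. Each of the three sets is listed
by `k` optional points, whence the cube. -/
theorem exists_isUniversal_of_lt {k : ℕ}
    (h : ((Fintype.card (Λ × β) + 1 : ℝ) ^ k) ^ 3 * Fintype.card Λ *
      (1 - (4 ^ k)⁻¹) ^ (Fintype.card β - k) < 1) :
    ∃ ω : Λ × β → Λ × β → Bool, IsUniversal k ω := by
  classical
  let pts : (Fin k → Option (Λ × β)) → Finset (Λ × β) := fun s =>
    (Finset.univ.image s).eraseNone
  have hpts : ∀ s, (pts s).card ≤ k := fun s => by
    refine (Finset.card_le_card_of_injOn some (t := Finset.univ.image s) ?_ ?_).trans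
      (Finset.card_image_le.trans (by simp))
    · intro x hx
      simpa [pts] using hx
    · exact fun _ _ _ _ h => Option.some_injective _ h
  have hsurj : ∀ S : Finset (Λ × β), S.card ≤ k → ∃ s, pts s = S := by
    intro S hS
    let e := S.equivFin
    refine ⟨fun i => if hi : i.1 < S.card then some (e.symm ⟨i, hi⟩).1 else none, ?_⟩
    ext x
    simp only [pts, Finset.mem_eraseNone, Finset.mem_image, Finset.mem_univ, true_and]
    constructor
    · rintro ⟨i, hi⟩
      split_ifs at hi
      obtain rfl := Option.some_injective _ hi
      exact (e.symm _).2
    · intro hx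
      refine ⟨⟨e ⟨x, hx⟩, (e ⟨x, hx⟩).2.trans_le hS⟩, ?_⟩
      simp
  let I := (Fin k → Option (Λ × β)) × (Fin k → Option (Λ × β)) × (Fin k → Option (Λ × β)) × Λ
  let bad : I → Finset (Λ × β → Λ × β → Bool) := fun i =>
    omitting (pts i.1) (fun x => decide (x ∈ pts i.2.1)) (fun x => decide (x ∈ pts i.2.2.1)) i.2.2.2
  have hcard : (Finset.univ.biUnion bad).card < Fintype.card (Λ × β → Λ × β → Bool) := by
    have h1 : ((Finset.univ.biUnion bad).card : ℝ) ≤ ∑ i : I, ((bad i).card : ℝ) := by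
      exact_mod_cast Finset.card_biUnion_le
    have h2 : ∑ i : I, ((bad i).card : ℝ) ≤ ∑ _i : I,
        (Fintype.card (Λ × β → Λ × β → Bool) * (1 - (4 ^ k)⁻¹) ^ (Fintype.card β - k) : ℝ) :=
      Finset.sum_le_sum fun i _ => card_omitting_le _ (hpts _) _ _ _
    rw [Finset.sum_const, Finset.card_univ, nsmul_eq_mul] at h2
    have hI : (Fintype.card I : ℝ) =
        ((Fintype.card (Λ × β) + 1 : ℝ) ^ k) ^ 3 * Fintype.card Λ := by
      simp only [I, Fintype.card_prod, Fintype.card_fun, Fintype.card_option, Fintype.card_fin]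
      push_cast
      ring
    have hpos : (0 : ℝ) < Fintype.card (Λ × β → Λ × β → Bool) := by
      exact_mod_cast Fintype.card_pos
    have : ((Finset.univ.biUnion bad).card : ℝ) < Fintype.card (Λ × β → Λ × β → Bool) := by
      refine (h1.trans h2).trans_lt ?_
      rw [hI]
      calc _ = Fintype.card (Λ × β → Λ × β → Bool) *
            (((Fintype.card (Λ × β) + 1 : ℝ) ^ k) ^ 3 * Fintype.card Λ *
              (1 - (4 ^ k)⁻¹) ^ (Fintype.card β - k)) := by ring
        _ < Fintype.card (Λ × β → Λ × β → Bool) * 1 := mul_lt_mul_of_pos_left h hpos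
        _ = _ := mul_one _
    exact_mod_cast this
  obtain ⟨ω, -, hω⟩ :=
    Finset.exists_mem_notMem_of_card_lt_card (hcard.trans_eq Finset.card_univ.symm)
  refine ⟨ω, fun S hS p q l => ?_⟩
  obtain ⟨s, rfl⟩ := hsurj S hS
  obtain ⟨sp, hsp⟩ := hsurj {x ∈ pts s | p x = true}
    ((Finset.card_le_card (Finset.filter_subset _ _)).trans hS)
  obtain ⟨sq, hsq⟩ := hsurj {x ∈ pts s | q x = true}
    ((Finset.card_le_card (Finset.filter_subset _ _)).trans hS)
  have hb : ω ∉ bad (s, sp, sq, l) := fun hb => hω (Finset.mem_biUnion.2 ⟨_, Finset.mem_univ _, hb⟩)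
  simp only [bad, omitting, Finset.mem_filter_univ, hsp, hsq] at hb
  push Not at hb
  obtain ⟨b, hb, hx⟩ := hb
  refine ⟨b, hb, fun x hxs => ?_⟩
  have := hx x hxs
  simpa [hxs] using this

/-- The number of possible failures is polynomial in the size of the classes, while the probability
of each decays exponentially. -/
theorem exists_isUniversal (Λ : Type) [Finite Λ] (k : ℕ) :
    ∃ (B : ℕ) (ω : Λ × Fin B → Λ × Fin B → Bool), IsUniversal k ω := by
  classical
  have := Fintype.ofFinite Λ
  set r : ℝ := 1 - (4 ^ k)⁻¹ with hr
  have hr0 : 0 < ((4 : ℝ) ^ k)⁻¹ := by positivity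
  have hle1 : ((4 : ℝ) ^ k)⁻¹ ≤ 1 := inv_le_one_of_one_le₀ (one_le_pow₀ (by norm_num))
  set C : ℝ := (Fintype.card Λ * (k + 1) + 1 : ℝ) with hC
  have hlim : Filter.Tendsto (fun n : ℕ => (C ^ (3 * k) * Fintype.card Λ * 2 ^ (3 * k)) *
      ((n : ℝ) ^ (3 * k) * r ^ n)) Filter.atTop (nhds 0) := by
    simpa using (tendsto_pow_const_mul_const_pow_of_lt_one (3 * k) (r := r)
      (by linarith) (by linarith)).const_mul (C ^ (3 * k) * Fintype.card Λ * 2 ^ (3 * k))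
  obtain ⟨n, hn1, hn⟩ := ((hlim.eventually_lt_const one_pos).and
    (Filter.eventually_ge_atTop 1)).exists
  refine ⟨n + k, exists_isUniversal_of_lt (lt_of_le_of_lt ?_ hn1)⟩
  rw [Fintype.card_fin, Nat.add_sub_cancel, ← pow_mul, Fintype.card_prod, Fintype.card_fin]
  have hn' : (1 : ℝ) ≤ n := by exact_mod_cast hn
  have hb : ((Fintype.card Λ * (n + k) : ℕ) + 1 : ℝ) ≤ C * 2 * n := by
    push_cast
    have hΛ : (0 : ℝ) ≤ Fintype.card Λ := by positivity
    have hk : (0 : ℝ) ≤ k := by positivity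
    rw [hC]
    have h1 : (n + k : ℝ) ≤ (k + 1) * n := by nlinarith
    have h2 : (Fintype.card Λ * (n + k) : ℝ) ≤ Fintype.card Λ * ((k + 1) * n) :=
      mul_le_mul_of_nonneg_left h1 hΛ
    have h3 : (0 : ℝ) ≤ Fintype.card Λ * ((k + 1) * n) := by positivity
    nlinarith
  have hrn : 0 ≤ r ^ n := pow_nonneg (by linarith) _
  calc ((Fintype.card Λ * (n + k) : ℕ) + 1 : ℝ) ^ (k * 3) * Fintype.card Λ * r ^ n
      ≤ (C * 2 * n) ^ (k * 3) * Fintype.card Λ * r ^ n := by gcongr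
    _ = _ := by rw [mul_pow, mul_pow, mul_comm k 3]; ring

end Universal

/-! ### The models and the pebble game between them. -/

section Models

/-- The label of a vertex: the part to which it belongs, the tuple of colours to which it is
attached (if it is special), an index, and its colour. -/
structure Label (N S : ℕ) where
  part : Fin (N + 1)
  tuple : Option (Fin S → Fin (N + 1))
  idx : Fin S
  col : Fin (N + 1)

instance (N S : ℕ) : Finite (Label N S) :=
  Finite.of_injective (fun l : Label N S => (l.part, l.tuple, l.idx, l.col)) fun l l' h => by
    cases l
    cases l'
    simpa using h

/-- For each part, the set of tuples of colours that it records. -/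
abbrev Record (N S : ℕ) : Type := ℕ → (Fin S → Fin (N + 1)) → Prop

variable {N S : ℕ}

namespace Label

variable (T : ℕ → ℕ)

/-- The labels that are used: ordinary labels of part `j` have an index less than `T j`, and there
are special labels with indices less than `2 * T j` for the recorded tuples. -/
def Valid (R : Record N S) (l : Label N S) : Prop :=
  match l.tuple with
  | none => l.idx.1 < T l.part
  | some u => l.idx.1 < 2 * T l.part ∧ R l.part u ∧ l.col = u l.idx

/-- Whether edges from vertices with label `l` to vertices with label `l'` are possible. -/
def Link (l l' : Label N S) : Prop :=
  l.part = l'.part ∧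
    if l.tuple.isSome ∧ l'.tuple.isSome then l.tuple = l'.tuple ∧ l.idx < l'.idx
    -- An ordinary label of index `p` is thereby excluded from both special indices `p` and `p + T
    -- j`, while a label whose residue is unused on the board is linked to everything there.
    else l.idx.1 % T l.part ≠ l'.idx.1 % T l.part

/-- The label with index `p` for the tuple `u` in part `j`. -/
def special (j : Fin (N + 1)) (u : Fin S → Fin (N + 1)) (p : Fin S) : Label N S :=
  ⟨j, some u, p, u p⟩

variable {T}

theorem Link.irrefl (l : Label N S) : ¬ l.Link T l := by
  rintro ⟨-, h⟩
  split_ifs at h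
  · exact lt_irrefl _ h.2
  · exact h rfl

theorem Link.idx_ne {l l' : Label N S} (h : l.Link T l') : l.idx ≠ l'.idx := by
  obtain ⟨-, h⟩ := h
  intro he
  split_ifs at h
  · exact h.2.ne he
  · exact h (by rw [he])

theorem Link.mod_ne {l l' : Label N S} (h : l.Link T l') (hn : l.tuple = none ∨ l'.tuple = none) :
    l.idx.1 % T l.part ≠ l'.idx.1 % T l.part := by
  obtain ⟨-, h⟩ := h
  rwa [if_neg] at h
  rintro ⟨h₁, h₂⟩
  rcases hn with hn | hn
  · simp [hn] at h₁
  · simp [hn] at h₂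

theorem link_of_mod_ne {l l' : Label N S} (hp : l.part = l'.part)
    (hn : l.tuple = none ∨ l'.tuple = none) (h : l.idx.1 % T l.part ≠ l'.idx.1 % T l.part) :
    l.Link T l' := by
  refine ⟨hp, ?_⟩
  rwa [if_neg]
  rintro ⟨h₁, h₂⟩
  rcases hn with hn | hn
  · simp [hn] at h₁
  · simp [hn] at h₂

theorem link_special {j : Fin (N + 1)} {u : Fin S → Fin (N + 1)} {p q : Fin S} (h : p < q) :
    (special j u p).Link T (special j u q) :=
  ⟨rfl, by simp [special, h]⟩

theorem valid_special {R : Record N S} {j : Fin (N + 1)} {u : Fin S → Fin (N + 1)} {p : Fin S}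
    (hp : p.1 < 2 * T j) (hu : R j u) : (special j u p).Valid T R :=
  ⟨hp, hu, rfl⟩

theorem eq_special {R : Record N S} {l : Label N S} (hl : l.Valid T R) {u : Fin S → Fin (N + 1)}
    (hu : l.tuple = some u) :
    l = special l.part u l.idx ∧ l.idx.1 < 2 * T l.part ∧ R l.part u := by
  obtain ⟨j, t, p, c⟩ := l
  simp only at hu
  subst hu
  obtain ⟨h₁, h₂, h₃⟩ := hl
  simp only at h₁ h₂ h₃
  subst h₃
  exact ⟨rfl, h₁, h₂⟩

theorem Valid.idx_lt {R : Record N S} {l : Label N S} (hl : l.Valid T R) :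
    l.idx.1 < 2 * T l.part := by
  obtain ⟨j, t, p, c⟩ := l
  cases t with
  | none =>
    have : p.1 < T j := hl
    simp only
    omega
  | some u => exact hl.1

theorem Valid.idx_lt_of_none {R : Record N S} {l : Label N S} (hl : l.Valid T R)
    (h : l.tuple = none) : l.idx.1 < T l.part := by
  rw [Valid, h] at hl
  exact hl

end Label

/-- The digraph with a chain of colours and coloured vertices; the edges between vertices are given
by the relation `ω`, so far as their labels admit them. -/
inductive Model (T : ℕ → ℕ) (R : Record N S) {B : ℕ}
    (ω : Label N S × Fin B → Label N S × Fin B → Bool) : Type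
  | chain (c : Fin (N + 1)) : Model T R ω
  | vert (l : Label N S) (h : l.Valid T R) (b : Fin B) : Model T R ω

namespace Model

variable {T : ℕ → ℕ} {R R' : Record N S} {B : ℕ}
  {ω : Label N S × Fin B → Label N S × Fin B → Bool}

instance : Finite (Model T R ω) :=
  Finite.of_injective
    (fun x : Model T R ω => match x with
      | chain c => (Sum.inl c : Fin (N + 1) ⊕ Label N S × Fin B)
      | vert l _ b => Sum.inr (l, b)) fun x y h => by
    cases x <;> cases y <;> simp_all

instance : Nonempty (Model T R ω) := ⟨chain 0⟩

/-- The edges of the model. -/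
def EdgeRel : Model T R ω → Model T R ω → Prop
  | chain c, chain c' => c ≤ c'
  | chain _, vert _ _ _ => False
  | vert l _ _, chain c => l.col = c
  | vert l _ b, vert l' _ b' => l.Link T l' ∧ ω (l, b) (l', b') = true

instance : Language.graph.Structure (Model T R ω) where
  RelMap | .adj => fun x => EdgeRel (x 0) (x 1)

@[simp]
theorem edge_chain_chain (c c' : Fin (N + 1)) :
    Edge (chain c : Model T R ω) (chain c') ↔ c ≤ c' := Iff.rfl

@[simp]
theorem not_edge_chain_vert (c : Fin (N + 1)) (l : Label N S) (h : l.Valid T R) (b : Fin B) :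
    ¬ Edge (chain c : Model T R ω) (vert l h b) := id

@[simp]
theorem edge_vert_chain (c : Fin (N + 1)) (l : Label N S) (h : l.Valid T R) (b : Fin B) :
    Edge (vert l h b : Model T R ω) (chain c) ↔ l.col = c := Iff.rfl

@[simp]
theorem edge_vert_vert (l l' : Label N S) (h : l.Valid T R) (h' : l'.Valid T R) (b b' : Fin B) :
    Edge (vert l h b : Model T R ω) (vert l' h' b') ↔
      l.Link T l' ∧ ω (l, b) (l', b') = true := Iff.rfl

/-- The part of a vertex. -/
def part : Model T R ω → Option ℕ
  | chain _ => none
  | vert l _ _ => some l.part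

/-- The label and the number of a vertex. -/
def point : Model T R ω → Option (Label N S × Fin B)
  | chain _ => none
  | vert l _ b => some (l, b)

@[simp] theorem part_chain (c : Fin (N + 1)) : (chain c : Model T R ω).part = none := rfl

@[simp] theorem part_vert (l : Label N S) (h : l.Valid T R) (b : Fin B) :
    (vert l h b : Model T R ω).part = some l.part.1 := rfl

@[simp] theorem point_chain (c : Fin (N + 1)) : (chain c : Model T R ω).point = none := rfl

@[simp] theorem point_vert (l : Label N S) (h : l.Valid T R) (b : Fin B) :
    (vert l h b : Model T R ω).point = some (l, b) := rfl

theorem edge_self_iff (x : Model T R ω) : Edge x x ↔ x.part = none := by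
  cases x with
  | chain c => simp
  | vert l h b => simp [Label.Link.irrefl]

theorem part_eq_of_edge {x y : Model T R ω} (h : Edge x y) (hy : y.part ≠ none) :
    x.part = y.part := by
  cases y with
  | chain c => simp at hy
  | vert l hl b =>
    cases x with
    | chain c => simp at h
    | vert l' hl' b' => simp [((edge_vert_vert ..).1 h).1.1]

/-- What formulas with few variables see of an element: the parts from number `i` on look alike. -/
def view (i : ℕ) : Model T R ω → Fin (N + 1) ⊕ Label N S ⊕ Fin (N + 1)
  | chain c => .inl c
  | vert l _ _ => if l.part.1 < i then .inr (.inl l) else .inr (.inr l.col)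

@[simp] theorem view_chain (i : ℕ) (c : Fin (N + 1)) :
    (chain c : Model T R ω).view i = .inl c := rfl

theorem view_vert_of_lt {i : ℕ} {l : Label N S} (hl : l.part.1 < i) (h : l.Valid T R)
    (b : Fin B) : (vert l h b : Model T R ω).view i = .inr (.inl l) := if_pos hl

theorem view_vert_of_le {i : ℕ} {l : Label N S} (hl : i ≤ l.part.1) (h : l.Valid T R)
    (b : Fin B) : (vert l h b : Model T R ω).view i = .inr (.inr l.col) := if_neg hl.not_gt

theorem eq_chain_of_view {i : ℕ} {x : Model T R ω} {c : Fin (N + 1)} (h : x.view i = .inl c) :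
    x = chain c := by
  cases x with
  | chain c' => simpa using h
  | vert l hl b =>
    by_cases hi : l.part.1 < i
    · simp [view_vert_of_lt hi] at h
    · simp [view_vert_of_le (not_lt.1 hi)] at h

theorem exists_vert_of_view {i : ℕ} {x : Model T R ω} {y : Model T R' ω}
    (h : x.view i = y.view i) {l : Label N S} {hl : l.Valid T R} {b : Fin B}
    (hx : x = vert l hl b) :
    ∃ l' hl' b', y = vert l' hl' b' ∧ l'.col = l.col ∧ (l.part.1 < i → l' = l) ∧
      (i ≤ l.part.1 → i ≤ l'.part.1) := by
  subst hx
  cases y with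
  | chain c => simpa using eq_chain_of_view h
  | vert l' hl' b' =>
    refine ⟨l', hl', b', rfl, ?_⟩
    by_cases h₁ : l.part.1 < i <;> by_cases h₂ : l'.part.1 < i
    · rw [view_vert_of_lt h₁, view_vert_of_lt h₂] at h
      obtain rfl : l = l' := by simpa using h
      exact ⟨rfl, fun _ => rfl, id⟩
    · rw [view_vert_of_lt h₁, view_vert_of_le (not_lt.1 h₂)] at h
      simp at h
    · rw [view_vert_of_lt h₂, view_vert_of_le (not_lt.1 h₁)] at h
      simp at h
    · rw [view_vert_of_le (not_lt.1 h₂), view_vert_of_le (not_lt.1 h₁)] at h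
      exact ⟨by simpa using h.symm, fun h => absurd h h₁, fun _ => not_lt.1 h₂⟩

theorem part_eq_none_iff_of_view {i : ℕ} {x : Model T R ω} {y : Model T R' ω}
    (h : x.view i = y.view i) : x.part = none ↔ y.part = none := by
  cases x with
  | chain c =>
    rw [eq_chain_of_view h.symm]
    simp
  | vert l hl b =>
    obtain ⟨l', hl', b', rfl, -⟩ := exists_vert_of_view h rfl
    simp

theorem edge_chain_iff_of_view {i : ℕ} {x : Model T R ω} {y : Model T R' ω}
    (h : x.view i = y.view i) (c : Fin (N + 1)) :
    (Edge x (chain c) ↔ Edge y (chain c)) ∧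
      (Edge (chain c : Model T R ω) x ↔ Edge (chain c : Model T R' ω) y) := by
  cases x with
  | chain c' =>
    rw [eq_chain_of_view h.symm]
    simp
  | vert l hl b =>
    obtain ⟨l', hl', b', rfl, hc, -⟩ := exists_vert_of_view h rfl
    simp [hc]

/-- Tuples that the pebble game does not distinguish. -/
def Alike (i : ℕ) {n : ℕ} (a : Fin n → Model T R ω) (b : Fin n → Model T R' ω) : Prop :=
  (∀ s, (a s).view i = (b s).view i) ∧ ∀ s t, (a s = a t ↔ b s = b t) ∧
    ((a s).part = (a t).part ↔ (b s).part = (b t).part) ∧ (Edge (a s) (a t) ↔ Edge (b s) (b t))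

theorem Alike.symm {i n : ℕ} {a : Fin n → Model T R ω} {b : Fin n → Model T R' ω}
    (h : Alike i a b) : Alike i b a :=
  ⟨fun s => (h.1 s).symm, fun s t => ⟨(h.2 s t).1.symm, (h.2 s t).2.1.symm, (h.2 s t).2.2.symm⟩⟩

theorem Alike.reindex {i m n : ℕ} {a : Fin n → Model T R ω} {b : Fin n → Model T R' ω}
    (h : Alike i a b) (f : Fin m → Fin n) : Alike i (a ∘ f) (b ∘ f) :=
  ⟨fun s => h.1 (f s), fun s t => h.2 (f s) (f t)⟩

theorem Alike.snoc {i n : ℕ} {a : Fin n → Model T R ω} {b : Fin n → Model T R' ω}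
    (h : Alike i a b) {x : Model T R ω} {y : Model T R' ω} (hv : x.view i = y.view i)
    (he : ∀ s, a s = x ↔ b s = y) (hp : ∀ s, (a s).part = x.part ↔ (b s).part = y.part)
    (h₁ : ∀ s, Edge (a s) x ↔ Edge (b s) y) (h₂ : ∀ s, Edge x (a s) ↔ Edge y (b s)) :
    Alike i (Fin.snoc a x : Fin (n + 1) → Model T R ω) (Fin.snoc b y : Fin (n + 1) → _) := by
  have hxy : Edge x x ↔ Edge y y := by
    rw [edge_self_iff, edge_self_iff, part_eq_none_iff_of_view hv]
  refine ⟨fun s => ?_, fun s t => ?_⟩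
  · refine Fin.lastCases ?_ (fun s => ?_) s
    · simpa using hv
    · simpa using h.1 s
  · refine Fin.lastCases ?_ (fun s => ?_) s <;> refine Fin.lastCases ?_ (fun t => ?_) t
    · simpa using hxy
    · simp only [Fin.snoc_last, Fin.snoc_castSucc]
      exact ⟨by rw [eq_comm, he, eq_comm], by rw [eq_comm, hp, eq_comm], h₂ t⟩
    · simp only [Fin.snoc_last, Fin.snoc_castSucc]
      exact ⟨he s, hp s, h₁ s⟩
    · simpa using h.2 s t

open Classical in
/-- The answer to a vertex with label `l` may be a vertex with label `l'` if these labels relate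
in the same way to those on the board. -/
theorem Alike.exists_of_label {i n k : ℕ} (hω : IsUniversal k ω) (hn : n ≤ k)
    {a : Fin n → Model T R ω} {b : Fin n → Model T R' ω} (h : Alike i a b)
    {l l' : Label N S} {hl : l.Valid T R} (hl' : l'.Valid T R') {z : Fin B}
    (hx : ∀ s, a s ≠ vert l hl z) (hv : ∀ w, (vert l hl z : Model T R ω).view i =
      (vert l' hl' w : Model T R' ω).view i)
    (hp : ∀ s, (a s).part = some l.part.1 ↔ (b s).part = some l'.part.1)
    (hlink : ∀ s m hm w m' hm' w', a s = vert m hm w → b s = vert m' hm' w' →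
      m'.part = l'.part → (l.Link T m → l'.Link T m') ∧ (m.Link T l → m'.Link T l')) :
    ∃ y, Alike i (Fin.snoc a (vert l hl z) : Fin (n + 1) → Model T R ω)
      (Fin.snoc b y : Fin (n + 1) → Model T R' ω) := by
  let P : Finset (Label N S × Fin B) := (Finset.univ.image fun s => (b s).point).eraseNone
  have hP : P.card ≤ k := by
    refine (Finset.card_le_card_of_injOn some (t := Finset.univ.image fun s => (b s).point)
      ?_ ?_).trans (Finset.card_image_le.trans (by simpa using hn))
    · intro x hx
      simpa [P] using hx
    · exact fun _ _ _ _ h => Option.some_injective _ h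
  have hmem : ∀ s m hm w, b s = vert m hm w → (m, w) ∈ P := fun s m hm w hs => by
    simp only [P, Finset.mem_eraseNone, Finset.mem_image, Finset.mem_univ, true_and]
    exact ⟨s, by simp [hs]⟩
  -- The pattern copies the edges of the given vertex. By `hlink` every edge that is wanted is
  -- admitted by the labels, and an edge that is not wanted is excluded by `ω` itself; so links need
  -- to be preserved in one direction only.
  obtain ⟨w, hw, hpat⟩ := hω P hP
    (fun q => decide (∃ s, (b s).point = some q ∧ Edge (vert l hl z) (a s)))
    (fun q => decide (∃ s, (b s).point = some q ∧ Edge (a s) (vert l hl z))) l'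
  have hpoint : ∀ s t m hm w, b s = vert m hm w → (b t).point = some (m, w) → a t = a s := by
    intro s t m hm w hs ht
    refine (h.2 t s).1.2 ?_
    cases hbt : b t with
    | chain c => simp [hbt] at ht
    | vert m' hm' w' =>
      rw [hbt] at ht
      obtain ⟨rfl, rfl⟩ : m' = m ∧ w' = w := by simpa using ht
      exact hs.symm
  refine ⟨vert l' hl' w, h.snoc (hv w) (fun s => ?_) (fun s => hp s) (fun s => ?_) fun s => ?_⟩
  · exact iff_of_false (hx s) fun hs => hw (hmem s _ _ _ hs)
  · cases hbs : b s with
    | chain c =>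
      rw [eq_chain_of_view ((h.1 s).trans (by rw [hbs]; rfl))]
      simp
    | vert m' hm' w' =>
      obtain ⟨m, hm, w₀, has, -⟩ := exists_vert_of_view (h.1 s).symm hbs
      rw [edge_vert_vert, (hpat _ (hmem s _ _ _ hbs)).2, decide_eq_true_iff]
      constructor
      · intro hE
        refine ⟨?_, s, by simp [hbs], hE⟩
        rw [has, edge_vert_vert] at hE
        have hpm := (hp s).1 (by rw [has, part_vert, hE.1.1])
        rw [hbs, part_vert, Option.some_inj] at hpm
        exact (hlink s _ _ _ _ _ _ has hbs (Fin.ext hpm)).2 hE.1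
      · rintro ⟨-, t, ht, hE⟩
        rwa [hpoint s t _ _ _ hbs ht] at hE
  · cases hbs : b s with
    | chain c =>
      have has := eq_chain_of_view ((h.1 s).trans (by rw [hbs]; rfl))
      rw [has]
      exact (edge_chain_iff_of_view (hv w) c).1
    | vert m' hm' w' =>
      obtain ⟨m, hm, w₀, has, -⟩ := exists_vert_of_view (h.1 s).symm hbs
      rw [edge_vert_vert, (hpat _ (hmem s _ _ _ hbs)).1, decide_eq_true_iff]
      constructor
      · intro hE
        refine ⟨?_, s, by simp [hbs], hE⟩
        rw [has, edge_vert_vert] at hE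
        have hpm := (hp s).1 (by rw [has, part_vert, hE.1.1])
        rw [hbs, part_vert, Option.some_inj] at hpm
        exact (hlink s _ _ _ _ _ _ has hbs (Fin.ext hpm)).1 hE.1
      · rintro ⟨-, t, ht, hE⟩
        rwa [hpoint s t _ _ _ hbs ht] at hE

/-- A vertex of a part before `i` is answered with the same label, which is valid because its record
is shared. A vertex of a later part, special or not, is answered by an ordinary vertex of the same
colour. -/
theorem Alike.exists_snoc {i n K k : ℕ} (hω : IsUniversal k ω) (hK : K ≤ k)
    (hR : ∀ j < i, ∀ u, R j u → R' j u) (hT : ∀ j, i ≤ j → j ≤ N → K ≤ T j ∧ T j ≤ S)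
    (hN : i + K ≤ N + 1) (hn : n + 1 ≤ K) {a : Fin n → Model T R ω} {b : Fin n → Model T R' ω}
    (h : Alike i a b) (x : Model T R ω) :
    ∃ y, Alike i (Fin.snoc a x : Fin (n + 1) → Model T R ω)
      (Fin.snoc b y : Fin (n + 1) → Model T R' ω) := by
  by_cases hx : ∃ s, a s = x
  · obtain ⟨s, rfl⟩ := hx
    refine ⟨b s, ?_⟩
    convert h.reindex (Fin.snoc id s : Fin (n + 1) → Fin n) using 1 <;>
    · ext t
      refine Fin.lastCases ?_ (fun t => ?_) t <;> simp
  push Not at hx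
  cases x with
  | chain c =>
    refine ⟨chain c, h.snoc rfl (fun s => ?_) (fun s => ?_) (fun s => ?_) fun s => ?_⟩
    · refine iff_of_false (hx s) fun hs => hx s (eq_chain_of_view (i := i) ?_)
      rw [h.1 s, hs]
      rfl
    · exact part_eq_none_iff_of_view (h.1 s)
    · exact (edge_chain_iff_of_view (h.1 s) c).1
    · exact (edge_chain_iff_of_view (h.1 s) c).2
  | vert l hl z =>
    have hnk : n ≤ k := by omega
    by_cases hli : l.part.1 < i
    · have hl' : l.Valid T R' := by
        obtain ⟨j, t, p, c⟩ := l
        cases t with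
        | none => exact hl
        | some u => exact ⟨hl.1, hR _ hli _ hl.2.1, hl.2.2⟩
      refine h.exists_of_label hω hnk hl' hx (fun w => ?_) (fun s => ?_) ?_
      · rw [view_vert_of_lt hli, view_vert_of_lt hli]
      · cases has : a s with
        | chain c =>
          have := h.1 s
          rw [has] at this
          rw [eq_chain_of_view this.symm]
          simp
        | vert m hm w =>
          obtain ⟨m', hm', w', hbs, -, h₁, h₂⟩ := exists_vert_of_view (h.1 s) has
          rw [hbs]
          simp only [part_vert, Option.some_inj]
          by_cases hmi : m.part.1 < i
          · rw [h₁ hmi]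
          · have := h₂ (not_lt.1 hmi)
            omega
      · intro s m hm w m' hm' w' has hbs hpart
        obtain ⟨m₁, hm₁, w₁, has', -, h₁, -⟩ := exists_vert_of_view (h.1 s).symm hbs
        have : m = m₁ := by
          rw [has] at has'
          cases has'
          rfl
        rw [this, h₁ (by rw [hpart]; exact hli)]
        exact ⟨id, id⟩
    · rw [not_lt] at hli
      obtain ⟨j, hij, hj⟩ : ∃ j : Fin (N + 1), i ≤ j.1 ∧
          ∀ s, (a s).part = some l.part.1 ↔ (b s).part = some j.1 := by
        by_cases hs : ∃ s, (a s).part = some l.part.1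
        · obtain ⟨s, hs⟩ := hs
          cases has : a s with
          | chain c => simp [has] at hs
          | vert m hm w =>
            obtain ⟨m', hm', w', hbs, -, -, h₂⟩ := exists_vert_of_view (h.1 s) has
            have hml : m.part.1 = l.part.1 := by simpa [has] using hs
            refine ⟨m'.part, h₂ (hml ▸ hli), fun t => ?_⟩
            have := (h.2 t s).2.1
            rwa [hs, hbs, part_vert] at this
        · push Not at hs
          -- At least `K` parts have a number from `i` on, and fewer than `K` elements are on the
          -- board, so some such part is unoccupied.
          obtain ⟨j, hj, hjb⟩ := Finset.exists_mem_notMem_of_card_lt_card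
            (s := (Finset.univ : Finset (Fin n)).image fun s => (b s).part)
            (t := (Finset.Icc i N).image some)
            (Finset.card_image_le.trans_lt (by
              rw [Finset.card_image_of_injective _ (Option.some_injective _)]
              simp
              omega))
          obtain ⟨j, hji, rfl⟩ := Finset.mem_image.1 hj
          rw [Finset.mem_Icc] at hji
          refine ⟨⟨j, by omega⟩, hji.1, fun s => iff_of_false (hs s) fun hbs => ?_⟩
          exact hjb (Finset.mem_image.2 ⟨s, Finset.mem_univ _, hbs⟩)
      obtain ⟨hKj, hSj⟩ := hT j hij (Nat.lt_succ_iff.1 j.2)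
      -- Since `n < K ≤ T j`, some residue `t` modulo `T j` is not used on the board; the ordinary
      -- label of index `t` is linked in both directions to all labels of part `j` there.
      obtain ⟨t, ht, htb⟩ := Finset.exists_mem_notMem_of_card_lt_card
        (s := (Finset.univ : Finset (Fin n)).image fun s =>
          match b s with
          | chain _ => 0
          | vert m _ _ => m.idx.1 % T j)
        (t := Finset.range (T j))
        (Finset.card_image_le.trans_lt (by simp; omega))
      rw [Finset.mem_range] at ht
      have hmod : ∀ s m' hm' w', b s = vert m' hm' w' → m'.idx.1 % T j ≠ t % T j := by
        intro s m' hm' w' hbs he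
        refine htb (Finset.mem_image.2 ⟨s, Finset.mem_univ _, ?_⟩)
        simp only [hbs]
        rw [he, Nat.mod_eq_of_lt ht]
      have hl' : (⟨j, none, ⟨t, by omega⟩, l.col⟩ : Label N S).Valid T R' := ht
      refine h.exists_of_label hω hnk hl' hx (fun w => ?_) hj ?_
      · rw [view_vert_of_le hli, view_vert_of_le hij]
      · intro s m hm w m' hm' w' has hbs hpart
        have hne := hmod s _ _ _ hbs
        refine ⟨fun _ => ?_, fun _ => ?_⟩
        · exact Label.link_of_mod_ne hpart.symm (.inl rfl) hne.symm
        · refine Label.link_of_mod_ne hpart (.inr rfl) ?_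
          rw [hpart]
          exact hne

/-- Models with the same records in the parts before number `i` admit a pebble system. -/
def pebbleSystem {i K k : ℕ} (hω : IsUniversal k ω) (hK : K ≤ k)
    (hR : ∀ j < i, ∀ u, R j u ↔ R' j u) (hT : ∀ j, i ≤ j → j ≤ N → K ≤ T j ∧ T j ≤ S)
    (hN : i + K ≤ N + 1) : PebbleSystem Language.graph (Model T R ω) (Model T R' ω) K where
  rel a b := Alike i a b
  reindex h f := h.reindex f
  eq_iff h s t := (h.2 s t).1
  relMap_iff h _ Q f := relMap_graph_iff Q f _ _ fun s t => (h.2 s t).2.2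
  forth hn h x := h.exists_snoc hω hK (fun j hj u => (hR j hj u).1) hT hN hn x
  back hn h y := by
    obtain ⟨x, hx⟩ := h.symm.exists_snoc hω hK (fun j hj u => (hR j hj u).2) hT hN hn y
    exact ⟨x, hx.symm⟩

end Model

end Models

/-! ### Longest transitive tournaments: telling the parts apart and reading their records. -/

section Tournaments

variable {M : Type*} [Language.graph.Structure M]

/-- A transitive tournament, listed in its order. -/
def Tour {m : ℕ} (x : Fin m → M) : Prop :=
  (∀ p, ¬ Edge (x p) (x p)) ∧ ∀ p q, p < q → Edge (x p) (x q)

/-- Vertices without a loop that have a common successor without a loop. -/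
def SamePart (x y : M) : Prop :=
  ¬ Edge x x ∧ ¬ Edge y y ∧ ∃ z, ¬ Edge z z ∧ Edge x z ∧ Edge y z

/-- There is a transitive tournament with `m` vertices in the part of `v`. -/
def HasTour (m : ℕ) (v : M) : Prop := ∃ x : Fin m → M, Tour x ∧ ∀ p, SamePart (x p) v

/-- The largest transitive tournaments in the part of `v` have `2 * T j` vertices. -/
def InPart (T : ℕ → ℕ) (j : ℕ) (v : M) : Prop :=
  HasTour (2 * T j) v ∧ ¬ HasTour (2 * T j + 1) v

theorem Tour.reindex {m n : ℕ} {x : Fin n → M} (h : Tour x) {f : Fin m → Fin n}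
    (hf : StrictMono f) : Tour (x ∘ f) :=
  ⟨fun p => h.1 (f p), fun _ _ hpq => h.2 _ _ (hf hpq)⟩

end Tournaments

/-- In a universal relation there are complete sets of points with given labels. -/
theorem IsUniversal.exists_complete {Λ β : Type} {k m : ℕ} {ω : Λ × β → Λ × β → Bool}
    (hω : IsUniversal k ω) (hm : m ≤ k) (l : Fin m → Λ) (q : Fin m) (z : β) :
    ∃ b : Fin m → β, b q = z ∧ ∀ p p', p ≠ p' → ω (l p, b p) (l p', b p') = true := by
  classical
  suffices h : ∀ A : Finset (Fin m), ∃ b : Fin m → β, b q = z ∧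
      ∀ p ∈ insert q A, ∀ p' ∈ insert q A, p ≠ p' → ω (l p, b p) (l p', b p') = true by
    obtain ⟨b, hb, h⟩ := h Finset.univ
    exact ⟨b, hb, fun p p' => h p (by simp) p' (by simp)⟩
  intro A
  induction A using Finset.induction_on with
  | empty =>
    refine ⟨fun _ => z, rfl, fun p hp p' hp' hne => absurd ?_ hne⟩
    simp only [Finset.insert_empty, Finset.mem_singleton] at hp hp'
    rw [hp, hp']
  | insert r A hr ih =>
    obtain ⟨b, hb, h⟩ := ih
    by_cases hrq : r ∈ insert q A
    · rw [Finset.insert_comm, Finset.insert_eq_of_mem hrq]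
      exact ⟨b, hb, h⟩
    obtain ⟨w, -, hw⟩ := hω ((insert q A).image fun p => (l p, b p))
      (Finset.card_image_le.trans ((Finset.card_le_univ _).trans (by simpa using hm)))
      (fun _ => true) (fun _ => true) (l r)
    have hw' : ∀ p ∈ insert q A, ω (l r, w) (l p, b p) = true ∧ ω (l p, b p) (l r, w) = true :=
      fun p hp => hw _ (Finset.mem_image_of_mem (fun p => (l p, b p)) hp)
    have hne : ∀ p ∈ insert q A, p ≠ r := fun p hp he => hrq (he ▸ hp)
    refine ⟨Function.update b r w, ?_, ?_⟩
    · rw [Function.update_of_ne (hne q (Finset.mem_insert_self _ _)), hb]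
    · intro p hp p' hp' hpp
      rw [Finset.insert_comm, Finset.mem_insert] at hp hp'
      rcases hp with rfl | hp <;> rcases hp' with rfl | hp'
      · exact absurd rfl hpp
      · rw [Function.update_self, Function.update_of_ne (hne _ hp')]
        exact (hw' _ hp').1
      · rw [Function.update_self, Function.update_of_ne (hne _ hp)]
        exact (hw' _ hp).2
      · rw [Function.update_of_ne (hne _ hp'), Function.update_of_ne (hne _ hp)]
        exact h _ hp _ hp' hpp

/-- The conditions on the parameters of a model under which its parts can be told apart. -/
structure Good {N S B : ℕ} (T : ℕ → ℕ) (R : Record N S)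
    (ω : Label N S × Fin B → Label N S × Fin B → Bool) : Prop where
  universal : IsUniversal S ω
  three_le : ∀ j, 3 ≤ T j
  strictMono : StrictMono T
  le : 2 * T N ≤ S
  zero : ∀ j, R j fun _ => 0
  support : ∀ j u, R j u → ∀ p : Fin S, 2 * T j ≤ p.1 → u p = 0

namespace Model

variable {N S B : ℕ} {T : ℕ → ℕ} {R : Record N S}
  {ω : Label N S × Fin B → Label N S × Fin B → Bool}

theorem two_mul_le (hG : Good T R ω) (j : Fin (N + 1)) : 2 * T j ≤ S :=
  (Nat.mul_le_mul_left 2 (hG.strictMono.monotone (Nat.lt_succ_iff.1 j.2))).trans hG.le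

theorem exists_vert_of_part {x : Model T R ω} {j : ℕ} (h : x.part = some j) :
    ∃ l hl b, x = vert l hl b ∧ l.part.1 = j := by
  cases x with
  | chain c => simp at h
  | vert l hl b => exact ⟨l, hl, b, rfl, by simpa using h⟩

/-- Two vertices occupy at most two residues. As `T j ≥ 3`, an ordinary label with a third residue
is linked to both, and universality provides a common successor with this label. -/
theorem samePart_iff (hG : Good T R ω) (x y : Model T R ω) :
    SamePart x y ↔ x.part ≠ none ∧ x.part = y.part := by
  classical
  constructor
  · rintro ⟨hx, -, z, hz, hxz, hyz⟩
    rw [edge_self_iff] at hx hz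
    exact ⟨hx, (part_eq_of_edge hxz hz).trans (part_eq_of_edge hyz hz).symm⟩
  · rintro ⟨hx, hxy⟩
    refine ⟨by rwa [edge_self_iff], by rwa [edge_self_iff, ← hxy], ?_⟩
    obtain ⟨j, hj⟩ := Option.ne_none_iff_exists'.1 hx
    obtain ⟨l, hl, b, rfl, rfl⟩ := exists_vert_of_part hj
    obtain ⟨l', hl', b', rfl, hp⟩ := exists_vert_of_part (hxy.symm.trans hj)
    have h3 := hG.three_le l.part
    have hS := two_mul_le hG l.part
    obtain ⟨t, ht, h₁, h₂⟩ : ∃ t < 3, l.idx.1 % T l.part ≠ t ∧ l'.idx.1 % T l.part ≠ t := by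
      by_contra! hcon
      have h0 := hcon 0
      have h1 := hcon 1
      have h2 := hcon 2
      omega
    have htT : t % T l.part = t := Nat.mod_eq_of_lt (by omega)
    let m : Label N S := ⟨l.part, none, ⟨t, by omega⟩, 0⟩
    have hm : m.Valid T R := show t < T l.part by omega
    obtain ⟨w, -, hw⟩ := hG.universal {(l, b), (l', b')} (Finset.card_le_two.trans (by omega))
      (fun _ => true) (fun _ => true) m
    refine ⟨vert m hm w, by simp [edge_self_iff], ⟨?_, (hw _ (by simp)).2⟩, ?_, (hw _ (by simp)).2⟩
    · exact Label.link_of_mod_ne rfl (.inr rfl) (by rwa [htT])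
    · refine Label.link_of_mod_ne (Fin.ext hp) (.inr rfl) ?_
      rw [hp]
      change _ ≠ t % T l.part
      rwa [htT]

theorem Tour.part_eq {m : ℕ} {x : Fin m → Model T R ω} (h : Tour x) (p q : Fin m) :
    (x p).part = (x q).part := by
  have hne : ∀ p, (x p).part ≠ none := fun p => by
    rw [Ne, ← edge_self_iff]
    exact h.1 p
  rcases lt_trichotomy p q with hpq | rfl | hpq
  · exact part_eq_of_edge (h.2 _ _ hpq) (hne q)
  · rfl
  · exact (part_eq_of_edge (h.2 _ _ hpq) (hne p)).symm

/-- The transitive tournaments with `2 * T j` vertices in part `j` are given by recorded tuples. -/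
theorem Tour.exists_record (hG : Good T R ω) (j : Fin (N + 1)) {x : Fin (2 * T j) → Model T R ω}
    (h : Tour x) (hj : ∀ p, (x p).part = some j.1) :
    ∃ u, R j u ∧ ∀ p, ∃ hl b, x p =
      vert (Label.special j u (Fin.castLE (two_mul_le hG j) p)) hl b := by
  have h3 := hG.three_le j
  choose l hl b hx hp using fun p => exists_vert_of_part (hj p)
  have hpart : ∀ p, (l p).part = j := fun p => Fin.ext (hp p)
  have hlink : ∀ p q, p < q → (l p).Link T (l q) := fun p q hpq => by
    have := h.2 p q hpq
    rw [hx p, hx q, edge_vert_vert] at this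
    exact this.1
  -- Linked labels have different indices, so each of the `2 * T j` indices occurs exactly once.
  let f : Fin (2 * T j) → Fin (2 * T j) := fun p => ⟨(l p).idx.1, by
    have := (hl p).idx_lt
    rwa [hpart] at this⟩
  have hinj : Function.Injective f := by
    intro p q hpq
    have hidx : (l p).idx = (l q).idx := Fin.ext (by simpa [f] using hpq)
    rcases lt_trichotomy p q with hlt | he | hlt
    · exact absurd hidx (hlink _ _ hlt).idx_ne
    · exact he
    · exact absurd hidx.symm (hlink _ _ hlt).idx_ne
  have hsurj : Function.Surjective f := Finite.injective_iff_surjective.1 hinj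
  -- An ordinary vertex has an index below `T j`; the vertex whose index is larger by `T j` also
  -- occurs, but the two are not linked.
  have hspec : ∀ p, (l p).tuple ≠ none := by
    intro p hnone
    have hlt := (hl p).idx_lt_of_none hnone
    rw [hpart] at hlt
    obtain ⟨q, hq⟩ := hsurj ⟨(l p).idx.1 + T j, by omega⟩
    have hq' : (l q).idx.1 = (l p).idx.1 + T j := by simpa [f] using hq
    have hmod : (l q).idx.1 % T j = (l p).idx.1 % T j := by rw [hq', Nat.add_mod_right]
    rcases lt_trichotomy p q with hpq | rfl | hpq
    · have := (hlink _ _ hpq).mod_ne (.inl hnone)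
      rw [hpart] at this
      exact this hmod.symm
    · omega
    · have := (hlink _ _ hpq).mod_ne (.inr hnone)
      rw [hpart] at this
      exact this hmod
  have hstep : ∀ p q, p < q → (l p).tuple = (l q).tuple ∧ (l p).idx < (l q).idx := by
    intro p q hpq
    have := (hlink p q hpq).2
    rwa [if_pos ⟨Option.isSome_iff_ne_none.2 (hspec p), Option.isSome_iff_ne_none.2 (hspec q)⟩]
      at this
  -- A strictly increasing map of a finite chain to itself is the identity, so the vertex at place
  -- `p` has index `p`.
  have hmono : StrictMono f := fun p q hpq => (hstep p q hpq).2
  have hid : ∀ p, f p = p := fun p => le_antisymm hmono.apply_le hmono.le_apply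
  let o : Fin (2 * T j) := ⟨0, by omega⟩
  obtain ⟨u, hu⟩ := Option.ne_none_iff_exists'.1 (hspec o)
  have htuple : ∀ p, (l p).tuple = some u := by
    intro p
    rcases eq_or_ne p o with rfl | hne
    · exact hu
    · rw [← hu]
      refine (hstep o p ?_).1.symm
      rw [Fin.lt_def]
      have : p.1 ≠ 0 := fun h => hne (Fin.ext h)
      simp only [o]
      omega
  refine ⟨u, ?_, fun p => ?_⟩
  · have := (Label.eq_special (hl o) (htuple o)).2.2
    rwa [hpart] at this
  · have he := (Label.eq_special (hl p) (htuple p)).1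
    rw [hpart, show (l p).idx = Fin.castLE (two_mul_le hG j) p from
      Fin.ext (by simpa [f] using congrArg Fin.val (hid p))] at he
    refine ⟨he ▸ hl p, b p, ?_⟩
    rw [hx p]
    congr

/-- Prescribing the vertex at place `q` gives longest tournaments through any given special vertex,
so that membership in such a tournament characterizes special vertices. -/
theorem exists_tour (hG : Good T R ω) {j : Fin (N + 1)} {u : Fin S → Fin (N + 1)} (hu : R j u)
    (q : Fin (2 * T j)) (z : Fin B) :
    ∃ b : Fin (2 * T j) → Fin B, b q = z ∧ Tour (fun p => (vert (Label.special j u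
      (Fin.castLE (two_mul_le hG j) p)) (Label.valid_special p.2 hu) (b p) : Model T R ω)) := by
  obtain ⟨b, hb, h⟩ := hG.universal.exists_complete (two_mul_le hG j)
    (fun p => Label.special j u (Fin.castLE (two_mul_le hG j) p)) q z
  refine ⟨b, hb, fun p => by simp [edge_self_iff], fun p p' hpp => ⟨?_, h p p' hpp.ne⟩⟩
  exact Label.link_special hpp

/-- In a longer tournament the windows from places 0 and 1 on would both be longest tournaments, so
the second vertex would have index 1 in one and index 0 in the other. Conversely, the zero tuple is
recorded in every part and provides a tournament of full length. -/
theorem hasTour_iff (hG : Good T R ω) {v : Model T R ω} {j : Fin (N + 1)}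
    (hv : v.part = some j.1) (m : ℕ) : HasTour m v ↔ m ≤ 2 * T j := by
  have h3 := hG.three_le j
  constructor
  · rintro ⟨x, hx, hp⟩
    by_contra! hlt
    have hpart : ∀ p, (x p).part = some j.1 := fun p => by
      rw [((samePart_iff hG _ _).1 (hp p)).2, hv]
    let f : Fin (2 * T j) → Fin m := fun p => ⟨p.1, by omega⟩
    let g : Fin (2 * T j) → Fin m := fun p => ⟨p.1 + 1, by omega⟩
    obtain ⟨u, -, hu⟩ := Tour.exists_record hG j (hx.reindex (f := f) fun p q hpq => hpq)
      fun p => hpart _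
    obtain ⟨u', -, hu'⟩ := Tour.exists_record hG j
      (hx.reindex (f := g) fun p q hpq => Nat.succ_lt_succ hpq) fun p => hpart _
    obtain ⟨_, _, h₁⟩ := hu ⟨1, by omega⟩
    obtain ⟨_, _, h₂⟩ := hu' ⟨0, by omega⟩
    have h12 := h₁.symm.trans h₂
    simp [Label.special] at h12
  · intro hm
    obtain ⟨z, -⟩ := hG.universal ∅ (by simp) (fun _ => true) (fun _ => true)
      (Label.special j (fun _ => 0) ⟨0, by have := two_mul_le hG j; omega⟩)
    obtain ⟨b, -, hb⟩ := exists_tour hG (hG.zero j) ⟨0, by omega⟩ z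
    refine ⟨_, hb.reindex (f := Fin.castLE hm) fun p q hpq => hpq, fun p => ?_⟩
    rw [samePart_iff hG, hv]
    exact ⟨by simp, rfl⟩

theorem inPart_iff (hG : Good T R ω) (v : Model T R ω) (j : ℕ) :
    InPart T j v ↔ v.part = some j := by
  cases hv : v.part with
  | none =>
    refine iff_of_false ?_ (by simp)
    rintro ⟨⟨x, -, hx⟩, -⟩
    have h3 := hG.three_le j
    have := (samePart_iff hG _ _).1 (hx ⟨0, by omega⟩)
    rw [hv] at this
    exact this.1 this.2
  | some j' =>
    obtain ⟨l, hl, b, rfl, rfl⟩ := exists_vert_of_part hv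
    rw [InPart, hasTour_iff hG hv, hasTour_iff hG hv, Option.some_inj,
      ← hG.strictMono.injective.eq_iff]
    omega

end Model

/-! ### Coding of tuples of elements by tuples of colours. -/

section Codes

/-- The kinds of elements: elements of the chain, vertices of the parts from number `i` on, and
vertices of the other parts, by part, by whether they are special, and by index. -/
abbrev Kind (T : ℕ → ℕ) (i : ℕ) : Type := Option (Option (Fin i × Bool × Fin (2 * T i + 1)))

/-- The kinds of the entries of a tuple and the relations between these entries. -/
abbrev Shape (T : ℕ → ℕ) (i n : ℕ) : Type :=
  (Fin n → Kind T i) × (Fin n → Fin n → Bool × Bool × Bool)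

/-- A number for each shape. -/
noncomputable def shapeNumber {T : ℕ → ℕ} {i n : ℕ} (σ : Shape T i n) : ℕ :=
  -- The shift by 1 keeps 0 free: the zero tuple is always recorded and must not be a code.
  Fintype.equivFin (Shape T i n) σ + 1

theorem shapeNumber_injective {T : ℕ → ℕ} {i n : ℕ} :
    Function.Injective (shapeNumber : Shape T i n → ℕ) := fun _ _ h =>
  (Fintype.equivFin (Shape T i n)).injective (Fin.ext (Nat.succ_injective h))

theorem shapeNumber_le {T : ℕ → ℕ} {i n : ℕ} (σ : Shape T i n) :
    shapeNumber σ ≤ Fintype.card (Shape T i n) :=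
  (Fintype.equivFin (Shape T i n) σ).2

/-- The entry of an `n`-tuple, and the number of a colour of this entry, that is recorded at
position `p` of the code of the tuple. -/
def position (n p : ℕ) : Option (Fin n × ℕ) :=
  if h : 1 ≤ p.unpair.1 ∧ p.unpair.1 - 1 < n then some (⟨p.unpair.1 - 1, h.2⟩, p.unpair.2) else none

theorem position_zero (n : ℕ) : position n 0 = none := by
  simp [position]

theorem position_pair {n : ℕ} (s : Fin n) (q : ℕ) :
    position n (Nat.pair (s + 1) q) = some (s, q) := by
  simp [position]

end Codes

namespace Model

variable {N S B : ℕ} {T : ℕ → ℕ} {R R' : Record N S}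
  {ω : Label N S × Fin B → Label N S × Fin B → Bool}

/-- The kind of an element. -/
def kind (i : ℕ) : Model T R ω → Kind T i
  | chain _ => none
  | vert l _ _ => some (if h : l.part.1 < i then
      some (⟨l.part, h⟩, l.tuple.isSome, Fin.ofNat (2 * T i + 1) l.idx) else none)

/-- The colours that belong to an element. -/
def colour (i : ℕ) : Model T R ω → ℕ → Fin (N + 1)
  | chain c, _ => c
  | vert l _ _, p =>
    match l.tuple with
    | none => l.col
    | some u => if l.part.1 < i then
        (if h : p % (2 * T l.part) < S then u ⟨p % (2 * T l.part), h⟩ else 0) else l.col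

theorem kind_vert_of_lt {i : ℕ} {l : Label N S} (h : l.part.1 < i) (hl : l.Valid T R)
    (b : Fin B) : (vert l hl b : Model T R ω).kind i =
      some (some (⟨l.part, h⟩, l.tuple.isSome, Fin.ofNat (2 * T i + 1) l.idx)) :=
  congrArg some (dif_pos h)

theorem colour_special {i p : ℕ} {l : Label N S} {u : Fin S → Fin (N + 1)} (hu : l.tuple = some u)
    (h : l.part.1 < i) (hp : p % (2 * T l.part) < S) {hl : l.Valid T R} {b : Fin B} :
    (vert l hl b : Model T R ω).colour i p = u ⟨p % (2 * T l.part), hp⟩ := by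
  simp only [colour, hu, h, if_true, hp, dif_pos]

open Classical in
/-- The shape of a tuple of elements. -/
noncomputable def shape (i : ℕ) {n : ℕ} (y : Fin n → Model T R ω) : Shape T i n :=
  (fun s => (y s).kind i, fun s t =>
    (decide (y s = y t), decide ((y s).part = (y t).part), decide (Edge (y s) (y t))))

/-- The code of a tuple of elements. -/
noncomputable def code (i : ℕ) {n : ℕ} (y : Fin n → Model T R ω) (p : Fin S) : Fin (N + 1) :=
  -- The tournaments of part `i` show only the positions below `2 * T i`; the others are 0, as
  -- `Good.support` demands.
  if p.1 < 2 * T i then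
    match position n p with
    | some (s, q) => (y s).colour i q
    | none => Fin.ofNat (N + 1) (shapeNumber (shape i y))
  else 0

/-- The colour at 0 settles chain elements, ordinary vertices and vertices of late parts. A special
vertex of an early part `j` is settled by its index and the entries of its tuple below `2 * T j`, as
the other entries vanish. -/
theorem view_eq_of_kind {i : ℕ} (hG : Good T R ω) (hG' : Good T R' ω) {x : Model T R ω}
    {y : Model T R' ω} (hk : x.kind i = y.kind i)
    (hc : ∀ p, (p = 0 ∨ ∃ j < i, p < 2 * T j) → x.colour i p = y.colour i p) :
    x.view i = y.view i := by
  cases x with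
  | chain c =>
    cases y with
    | chain c' => exact congrArg Sum.inl (hc 0 (.inl rfl))
    | vert l hl b => simp [kind] at hk
  | vert l hl b =>
    cases y with
    | chain c' => simp [kind] at hk
    | vert l' hl' b' =>
      by_cases h : l.part.1 < i <;> by_cases h' : l'.part.1 < i
      · simp only [kind, h, h', dif_pos, Option.some_inj, Prod.mk.injEq, Fin.mk.injEq] at hk
        obtain ⟨hp, ht, hi⟩ := hk
        have hp' : l.part = l'.part := Fin.ext hp
        have hm := hG.strictMono h
        have hidx : l.idx = l'.idx := by
          have h₁ := hl.idx_lt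
          have h₂ := hl'.idx_lt
          rw [← hp'] at h₂
          have := congrArg Fin.val hi
          simp only [Fin.ofNat, Fin.val_mk] at this
          rw [Nat.mod_eq_of_lt (by omega), Nat.mod_eq_of_lt (by omega)] at this
          exact Fin.ext this
        rw [view_vert_of_lt h, view_vert_of_lt h']
        refine congrArg _ (congrArg _ ?_)
        cases hu : l.tuple with
        | none =>
          have hu' : l'.tuple = none := by simpa [hu] using ht
          have hcol := hc 0 (.inl rfl)
          simp only [colour, hu, hu'] at hcol
          obtain ⟨_, _, _, _⟩ := l
          obtain ⟨_, _, _, _⟩ := l'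
          simp_all
        | some u =>
          obtain ⟨u', hu'⟩ : ∃ u', l'.tuple = some u' := by
            rw [hu] at ht
            exact Option.isSome_iff_exists.1 ht.symm
          obtain ⟨e, -, hr⟩ := Label.eq_special hl hu
          obtain ⟨e', -, hr'⟩ := Label.eq_special hl' hu'
          rw [e, e', hidx, hp']
          congr 1
          funext p
          by_cases hlt : p.1 < 2 * T l.part
          · have := hc p.1 (.inr ⟨l.part, h, hlt⟩)
            simp only [colour, hu, hu', h, if_true, ← hp', Nat.mod_eq_of_lt hlt, p.2,
              dif_pos] at this
            exact this
          · rw [hG.support _ _ hr p (not_lt.1 hlt),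
              hG'.support _ _ hr' p (by rw [← hp']; exact not_lt.1 hlt)]
      · simp [kind, h, h'] at hk
      · simp [kind, h, h'] at hk
      · rw [view_vert_of_le (not_lt.1 h), view_vert_of_le (not_lt.1 h')]
        refine congrArg _ (congrArg _ ?_)
        have hcol := hc 0 (.inl rfl)
        simp only [colour, h, h', if_false] at hcol
        split at hcol <;> split at hcol <;> exact hcol

/-- A tuple is determined by its code as far as the pebble game is concerned. -/
theorem alike_of_code_eq {i n : ℕ} (hG : Good T R ω) (hG' : Good T R' ω) (hi : i ≤ N)
    (hN : Fintype.card (Shape T i n) ≤ N)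
    (hT : ∀ s < n, ∀ q, (q = 0 ∨ ∃ j < i, q < 2 * T j) → Nat.pair (s + 1) q < 2 * T i)
    {x : Fin n → Model T R ω} {y : Fin n → Model T R' ω} (h : code i x = code i y) :
    Alike i x y := by
  have hS : 2 * T i ≤ S := two_mul_le hG ⟨i, Nat.lt_succ_of_le hi⟩
  have h3 := hG.three_le i
  -- Position 0 of a code holds the shape number, which by `hN` is not altered by reduction modulo
  -- `N + 1`.
  have hshape : shape i x = shape i y := by
    have := congrFun h ⟨0, by omega⟩
    simp only [code, position_zero] at this
    rw [if_pos (by omega), if_pos (by omega)] at this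
    have := congrArg Fin.val this
    simp only [Fin.ofNat, Fin.val_mk] at this
    rw [Nat.mod_eq_of_lt (Nat.lt_succ_of_le ((shapeNumber_le _).trans hN)),
      Nat.mod_eq_of_lt (Nat.lt_succ_of_le ((shapeNumber_le _).trans hN))] at this
    exact shapeNumber_injective this
  refine ⟨fun s => view_eq_of_kind hG hG' (congrFun (congrArg Prod.fst hshape) s)
    fun q hq => ?_, fun s t => ?_⟩
  · have hlt := hT s s.2 q hq
    have := congrFun h ⟨Nat.pair (s + 1) q, by omega⟩
    simp only [code, position_pair, if_pos hlt] at this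
    exact this
  · have := congrFun (congrFun (congrArg Prod.snd hshape) s) t
    simpa [shape] using this

/-- This separates codes from the zero tuple, whose presence in a record says nothing about the
formula. -/
theorem code_ne_zero {i n : ℕ} (hG : Good T R ω) (hi : i ≤ N)
    (hN : Fintype.card (Shape T i n) ≤ N) (y : Fin n → Model T R ω) : code i y ≠ fun _ => 0 := by
  intro h
  have hS : 2 * T i ≤ S := two_mul_le hG ⟨i, Nat.lt_succ_of_le hi⟩
  have h3 := hG.three_le i
  have := congrFun h ⟨0, by omega⟩
  simp only [code, position_zero] at this
  rw [if_pos (by omega)] at this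
  have := congrArg Fin.val this
  simp only [Fin.ofNat, Fin.val_mk] at this
  rw [Nat.mod_eq_of_lt (Nat.lt_succ_of_le ((shapeNumber_le _).trans hN))] at this
  simp [shapeNumber] at this

/-- The only looped successor of a vertex is its colour. -/
theorem edge_self_and_edge_iff {x y : Model T R ω} (hx : ¬ Edge x x) :
    (Edge y y ∧ Edge x y) ↔ ∃ l hl b, x = vert l hl b ∧ y = chain l.col := by
  cases x with
  | chain c => simp at hx
  | vert l hl b =>
    cases y with
    | chain c =>
      simp only [edge_chain_chain, le_refl, edge_vert_chain, true_and]
      constructor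
      · rintro rfl
        exact ⟨l, hl, b, rfl, rfl⟩
      · rintro ⟨l', hl', b', h, hc⟩
        cases h
        cases hc
        rfl
    | vert l' hl' b' => simp [edge_self_iff]

theorem kind_eq_none_iff (i p : ℕ) (x y : Model T R ω) :
    (x.kind i = none ∧ y = chain (x.colour i p)) ↔ Edge x x ∧ y = x := by
  cases x with
  | chain c => simp [kind, colour]
  | vert l hl b => simp [kind, edge_self_iff]

theorem kind_eq_some_none_iff (hG : Good T R ω) (i p : ℕ) (x y : Model T R ω) :
    (x.kind i = some none ∧ y = chain (x.colour i p)) ↔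
      ¬ Edge x x ∧ (∀ j : Fin i, ¬ InPart T j x) ∧ Edge y y ∧ Edge x y := by
  cases x with
  | chain c => simp [kind]
  | vert l hl b =>
    have hx : ¬ Edge (vert l hl b : Model T R ω) (vert l hl b) := by simp [edge_self_iff]
    rw [edge_self_and_edge_iff hx]
    simp only [inPart_iff hG, part_vert, hx, not_false_eq_true, true_and, kind, Option.some_inj,
      dite_eq_right_iff, reduceCtorEq, imp_false, not_lt]
    have h₁ : (∀ j : Fin i, ¬ l.part.1 = j.1) ↔ i ≤ l.part.1 :=
      ⟨fun h => not_lt.1 fun hlt => h ⟨_, hlt⟩ rfl, fun h j hj => by have := j.2; omega⟩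
    rw [h₁]
    refine and_congr_right fun hi => ?_
    have hcol : (vert l hl b : Model T R ω).colour i p = l.col := by
      simp only [colour, hi.not_gt, if_false]
      split <;> rfl
    rw [hcol]
    constructor
    · rintro rfl
      exact ⟨l, hl, b, rfl, rfl⟩
    · rintro ⟨l', hl', b', h, hc⟩
      cases h
      exact hc

/-- The vertices of the longest transitive tournaments are special. -/
theorem eq_special_of_tour (hG : Good T R ω) {x : Model T R ω} {j : Fin (N + 1)}
    (hx : x.part = some j.1) (q : Fin (2 * T j)) {z : Fin (2 * T j) → Model T R ω}
    (hz : Tour z) (hzq : z q = x) : ∃ u hl b, R j u ∧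
      x = vert (Label.special j u (Fin.castLE (two_mul_le hG j) q)) hl b ∧
      ∀ p, ∃ hl b, z p = vert (Label.special j u (Fin.castLE (two_mul_le hG j) p)) hl b := by
  subst hzq
  obtain ⟨u, hu, h⟩ := Tour.exists_record hG j hz fun p => (Tour.part_eq hz p q).trans hx
  obtain ⟨hl, b, hq⟩ := h q
  exact ⟨u, hl, b, hu, hq, h⟩

/-- The special vertices of a part are those on its longest tournaments. The place of the vertex on
such a tournament is its index, and the other vertices of that tournament show the remaining entries
of its tuple. -/
theorem kind_eq_special_iff (hG : Good T R ω) (i p : ℕ) (hi : i ≤ N + 1) (j : Fin i)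
    (t : Fin (2 * T i + 1)) (x y : Model T R ω) :
    (x.kind i = some (some (j, true, t)) ∧ y = chain (x.colour i p)) ↔
      InPart T j x ∧ ∃ z : Fin (2 * T j) → Model T R ω, Tour z ∧ ∃ q, q.1 = t.1 ∧ z q = x ∧
        ∃ r : Fin (2 * T j), r.1 = p % (2 * T j) ∧ Edge y y ∧ Edge (z r) y := by
  have h3 := hG.three_le j
  have hmono : T j < T i := hG.strictMono j.2
  let j' : Fin (N + 1) := ⟨j, by omega⟩
  have hS : 2 * T j ≤ S := two_mul_le hG j'
  have hpS : p % (2 * T j) < 2 * T j := Nat.mod_lt _ (by omega)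
  rw [inPart_iff hG]
  constructor
  · rintro ⟨hk, rfl⟩
    cases x with
    | chain c => simp [kind] at hk
    | vert l hl b =>
      simp only [kind, Option.some_inj, Option.dite_none_right_eq_some, Prod.mk.injEq] at hk
      obtain ⟨hpi, rfl, hsome, rfl⟩ := hk
      refine ⟨rfl, ?_⟩
      obtain ⟨u, hu⟩ := Option.isSome_iff_exists.1 hsome
      obtain ⟨he, hlt, hr⟩ := Label.eq_special hl hu
      obtain ⟨f, hf, hz⟩ := exists_tour hG hr ⟨l.idx, hlt⟩ b
      refine ⟨_, hz, ⟨l.idx, hlt⟩, ?_, ?_, ⟨p % (2 * T l.part), hpS⟩, rfl, by simp, ?_⟩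
      · simp only [Fin.ofNat]
        rw [Nat.mod_eq_of_lt]
        simp only at hmono
        omega
      · rw [hf]
        congr 1
        exact he.symm
      · rw [edge_vert_chain]
        rw [colour_special hu hpi (hpS.trans_le hS)]
        rfl
  · rintro ⟨hpart, z, hz, q, hq, hzq, r, hr, hy, hE⟩
    obtain ⟨u, hl, b, hu, rfl, h⟩ := eq_special_of_tour (j := j') hG hpart q hz hzq
    obtain ⟨hl', b', hzr⟩ := h r
    constructor
    · rw [kind_vert_of_lt (show (Label.special j' u _).part.1 < i from j.2)]
      refine congrArg _ (congrArg _ (Prod.ext rfl (Prod.ext rfl (Fin.ext ?_))))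
      simp only [Label.special]
      simp only [Fin.ofNat, Fin.val_castLE]
      rw [hq, Nat.mod_eq_of_lt t.2]
    · have hn : ¬ Edge (z r) (z r) := hz.1 r
      obtain ⟨l₁, hl₁, b₁, e₁, rfl⟩ := (edge_self_and_edge_iff hn).1 ⟨hy, hE⟩
      rw [hzr] at e₁
      cases e₁
      rw [colour_special (u := u) rfl j.2 (hpS.trans_le hS)]
      exact congrArg chain (congrArg u (Fin.ext hr))

/-- Ordinary vertices lie on no longest tournament. The index of such a vertex is the `t < T j` for
which it has no edge to the vertex at place `t` of any longest tournament: equal residues forbid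
these edges, and different ones allow them. -/
theorem kind_eq_ordinary_iff (hG : Good T R ω) (i p : ℕ) (hi : i ≤ N + 1) (j : Fin i)
    (t : Fin (2 * T i + 1)) (x y : Model T R ω) :
    (x.kind i = some (some (j, false, t)) ∧ y = chain (x.colour i p)) ↔
      InPart T j x ∧ t.1 < T j ∧
        (∀ z : Fin (2 * T j) → Model T R ω, Tour z → ∀ q, InPart T j (z q) →
          ¬ z q = x ∧ (q.1 = t.1 → ¬ Edge x (z q))) ∧ Edge y y ∧ Edge x y := by
  have h3 := hG.three_le j
  have hmono : T j < T i := hG.strictMono j.2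
  let j' : Fin (N + 1) := ⟨j, by omega⟩
  have hS : 2 * T j ≤ S := two_mul_le hG j'
  simp only [inPart_iff hG]
  constructor
  · rintro ⟨hk, rfl⟩
    cases x with
    | chain c => simp [kind] at hk
    | vert l hl b =>
      simp only [kind, Option.some_inj, Option.dite_none_right_eq_some, Prod.mk.injEq] at hk
      obtain ⟨hpi, rfl, hnone, rfl⟩ := hk
      have hnone' : l.tuple = none := by simpa using hnone
      have hlt := hl.idx_lt_of_none hnone'
      simp only at hmono h3
      have hmod : (Fin.ofNat (2 * T i + 1) l.idx).1 = l.idx.1 := by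
        simp only [Fin.ofNat]
        exact Nat.mod_eq_of_lt (by omega)
      refine ⟨rfl, by rwa [hmod], fun z hz q hq => ?_, by simp, ?_⟩
      · obtain ⟨u, hl', b', hu, hzq, -⟩ :=
          eq_special_of_tour (j := l.part) hG hq q hz rfl
        rw [hzq, hmod]
        constructor
        · intro he
          rw [vert.injEq] at he
          cases (congrArg Label.tuple he.1).trans hnone'
        · intro hqt hE
          refine (((edge_vert_vert ..).1 hE).1).mod_ne (.inl hnone') ?_
          simp [Label.special, hqt]
      · simp [colour, hnone']
  · rintro ⟨hpart, ht, h, hyE⟩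
    obtain ⟨l, hl, b, rfl, hlj⟩ := exists_vert_of_part hpart
    have hj' : l.part = j' := Fin.ext hlj
    have hx : ¬ Edge (vert l hl b : Model T R ω) (vert l hl b) := by simp [edge_self_iff]
    obtain ⟨l₁, hl₁, b₁, e₁, rfl⟩ := (edge_self_and_edge_iff hx).1 hyE
    cases e₁
    have hnone : l.tuple = none := by
      by_contra hne
      obtain ⟨u, hu⟩ := Option.ne_none_iff_exists'.1 hne
      obtain ⟨he, hlt, hr⟩ := Label.eq_special hl hu
      obtain ⟨j₀, hj₀⟩ : ∃ j₀, j₀ = l.part := ⟨_, rfl⟩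
      rw [← hj₀] at he hlt hr
      obtain rfl : j₀ = j' := hj₀.trans hj'
      obtain ⟨f, hf, hz⟩ := exists_tour (j := j') hG hr ⟨l.idx, hlt⟩ b
      refine (h _ hz ⟨l.idx, hlt⟩ rfl).1 ?_
      rw [hf]
      congr 1
      exact he.symm
    have hlt := hl.idx_lt_of_none hnone
    rw [hj'] at hlt
    -- If the indices differed, universality would give an edge to a special vertex of index `t` for
    -- the zero tuple, and a longest tournament passes through that vertex.
    have hidx : l.idx.1 = t.1 := by
      by_contra hne
      let m : Label N S := Label.special j' (fun _ => 0) ⟨t.1, by omega⟩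
      obtain ⟨w, -, hw⟩ := hG.universal {(l, b)} (by rw [Finset.card_singleton]; omega)
        (fun _ => true) (fun _ => true) m
      obtain ⟨f, hf, hz⟩ := exists_tour (j := j') hG (hG.zero j') ⟨t.1, by simp only [j']; omega⟩ w
      refine (h _ hz ⟨t.1, by omega⟩ rfl).2 rfl ⟨?_, ?_⟩
      · refine Label.link_of_mod_ne hj' (.inl hnone) ?_
        rw [hj']
        change l.idx.1 % T j ≠ t.1 % T j
        rwa [Nat.mod_eq_of_lt hlt, Nat.mod_eq_of_lt ht]
      · rw [hf]
        exact (hw _ (by simp)).2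
    constructor
    · simp only [kind, hlj, j.2, dif_pos, hnone, Option.isSome_none, Option.some_inj,
        Prod.mk.injEq, true_and, Fin.eta]
      refine Fin.ext ?_
      simp only [Fin.ofNat]
      rw [hidx, Nat.mod_eq_of_lt t.2]
    · simp [colour, hnone]

/-- The elements of the chain are determined by their predecessors. -/
theorem eq_chain_iff (q : ℕ) (hq : q ≤ N) (x : Model T R ω) :
    x = chain (Fin.ofNat (N + 1) q) ↔ Edge x x ∧ ∀ z, (Edge z z ∧ Edge z x ∧ ¬ z = x) ↔
      ∃ r : Fin q, z = chain (Fin.ofNat (N + 1) r) := by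
  have hval : ∀ r ≤ q, (Fin.ofNat (N + 1) r).1 = r := fun r hr => by
    simp only [Fin.ofNat]
    exact Nat.mod_eq_of_lt (by omega)
  constructor
  · rintro rfl
    refine ⟨by simp, fun z => ?_⟩
    cases z with
    | chain c =>
      simp only [edge_chain_chain, le_refl, true_and, chain.injEq, Fin.ext_iff, Fin.le_def,
        hval q le_rfl]
      constructor
      · rintro ⟨h₁, h₂⟩
        exact ⟨⟨c, by omega⟩, (hval _ h₁).symm⟩
      · rintro ⟨r, hr⟩
        rw [hval _ r.2.le] at hr
        have := r.2
        omega
    | vert l hl b => simp [edge_self_iff]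
  · rintro ⟨hx, h⟩
    cases x with
    | vert l hl b => simp [edge_self_iff] at hx
    | chain c =>
      rw [chain.injEq, Fin.ext_iff, hval q le_rfl]
      by_contra hne
      rcases lt_or_gt_of_ne hne with hlt | hlt
      · have := (h (chain c)).2 ⟨⟨c, hlt⟩, by
          rw [chain.injEq, Fin.ext_iff, hval _ hlt.le]⟩
        exact this.2.2 rfl
      · obtain ⟨r, hr⟩ := (h (chain (Fin.ofNat (N + 1) q))).1 ⟨by simp, by
          rw [edge_chain_chain, Fin.le_def, hval q le_rfl]
          omega, by
          rw [chain.injEq, Fin.ext_iff, hval q le_rfl]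
          omega⟩
        rw [chain.injEq, Fin.ext_iff, hval q le_rfl, hval _ r.2.le] at hr
        have := r.2
        omega

end Model

/-! ### First-order definitions of parts, kinds, colours and shapes. -/

section DigraphDefinability

variable {ι : Type*} {G : ι → Type*} [∀ k, Language.graph.Structure (G k)] {α : Type}

namespace Def

theorem iff {L : FirstOrder.Language} {G : ι → Type*} [∀ k, L.Structure (G k)]
    {Q Q' : ∀ k, (α → G k) → Prop} (h : Def L G Q) (h' : Def L G Q') :
    Def L G fun k a => Q k a ↔ Q' k a :=
  ((h.imp h').and (h'.imp h)).congr fun _ _ => iff_iff_implies_and_implies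

theorem decide_eq {L : FirstOrder.Language} {G : ι → Type*} [∀ k, L.Structure (G k)]
    {Q : ∀ k, (α → G k) → Prop} [∀ k a, Decidable (Q k a)] (h : Def L G Q)
    (b : Bool) :
    Def L G fun k a => decide (Q k a) = b := by
  cases b
  · exact h.not.congr fun _ _ => decide_eq_false_iff_not
  · exact h.congr fun _ _ => decide_eq_true_iff

theorem tour {m : ℕ} (x : Fin m → α) :
    Def Language.graph G fun _ a => Tour fun p => a (x p) :=
  .and (.forall_finite fun _ => (Def.edge _ _).not)
    (.forall_finite fun _ => .forall_finite fun _ => .imp (.const _) (.edge _ _))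

theorem samePart (x y : α) : Def Language.graph G fun _ a => SamePart (a x) (a y) :=
  .and (Def.edge _ _).not (.and (Def.edge _ _).not
    (.exists_elem (.and (Def.edge _ _).not (.and (.edge _ _) (.edge _ _)))))

theorem hasTour (m : ℕ) (x : α) : Def Language.graph G fun _ a => HasTour m (a x) :=
  .exists_tuple (.and (.tour _) (.forall_finite fun _ => .samePart _ _))

theorem inPart (T : ℕ → ℕ) (j : ℕ) (x : α) : Def Language.graph G fun _ a => InPart T j (a x) :=
  .and (.hasTour _ _) (Def.hasTour _ _).not

end Def

end DigraphDefinability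

section ModelDefinability

variable {ι : Type*} {N S B : ι → ℕ} {T : ℕ → ℕ} {R : ∀ k, Record (N k) (S k)}
  {ω : ∀ k, Label (N k) (S k) × Fin (B k) → Label (N k) (S k) × Fin (B k) → Bool} {α : Type}

namespace Def

/-- Kind and colour are defined together because the way to read off a colour depends on the kind.
-/
theorem kind_and_colour (hG : ∀ k, Good T (R k) (ω k)) {i : ℕ} (hi : ∀ k, i ≤ N k + 1)
    (κ : Kind T i) (p : ℕ) (x y : α) :
    Def Language.graph (fun k => Model T (R k) (ω k)) fun _ a =>
      (a x).kind i = κ ∧ a y = .chain ((a x).colour i p) := by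
  match κ with
  | none =>
    exact ((Def.edge x x).and (Def.eq y x)).congr fun k a => Model.kind_eq_none_iff ..
  | some none =>
    exact ((Def.edge x x).not.and (.and (.forall_finite fun j : Fin i => (Def.inPart T j x).not)
      ((Def.edge y y).and (.edge x y)))).congr fun k a => Model.kind_eq_some_none_iff (hG k) ..
  | some (some (j, true, t)) =>
    refine Def.congr ?_ fun k a => Model.kind_eq_special_iff (hG k) i p (hi k) j t (a x) (a y)
    exact .and (.inPart _ _ _) (.exists_tuple (.and (.tour _) (.exists_finite fun q =>
      .and (.const _) (.and (.eq _ _) (.exists_finite fun r =>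
        .and (.const _) (.and (.edge _ _) (.edge _ _)))))))
  | some (some (j, false, t)) =>
    refine Def.congr ?_ fun k a => Model.kind_eq_ordinary_iff (hG k) i p (hi k) j t (a x) (a y)
    exact .and (.inPart _ _ _) (.and (.const _) (.and (.forall_tuple (.imp (.tour _)
      (.forall_finite fun q => .imp (.inPart _ _ _) (.and (Def.eq _ _).not
        (.imp (.const _) (Def.edge _ _).not))))) (.and (.edge _ _) (.edge _ _))))

theorem eq_chain (q : ℕ) (hq : ∀ k, q ≤ N k) (x : α) :
    Def Language.graph (fun k => Model T (R k) (ω k)) fun k a =>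
      a x = .chain (Fin.ofNat (N k + 1) q) := by
  induction q using Nat.strong_induction_on generalizing α with
  | _ q ih =>
    refine Def.congr ?_ fun k a => Model.eq_chain_iff q (hq k) (a x)
    exact .and (.edge _ _) (.forall_elem (.iff (.and (.edge _ _) (.and (.edge _ _)
      (Def.eq _ _).not)) (.exists_finite fun r => ih r r.2 (fun k => r.2.le.trans (hq k)) _)))

theorem kind_eq (hG : ∀ k, Good T (R k) (ω k)) {i : ℕ} (hi : ∀ k, i ≤ N k + 1)
    (κ : Kind T i) (x : α) :
    Def Language.graph (fun k => Model T (R k) (ω k)) fun _ a => (a x).kind i = κ := by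
  refine Def.congr (.exists_elem (R := fun _ a b =>
    (a x).kind i = κ ∧ b = .chain ((a x).colour i 0))
    (kind_and_colour hG hi κ 0 (Sum.inl x) (Sum.inr ()))) fun k a => ?_
  simp

theorem part_eq (hG : ∀ k, Good T (R k) (ω k)) (x y : α) :
    Def Language.graph (fun k => Model T (R k) (ω k)) fun _ a => (a x).part = (a y).part := by
  refine ((Def.samePart x y).or ((Def.edge x x).and (Def.edge y y))).congr fun k a => ?_
  rw [Model.samePart_iff (hG k), Model.edge_self_iff, Model.edge_self_iff]
  grind

open Classical in
theorem shape_eq (hG : ∀ k, Good T (R k) (ω k)) {i n : ℕ} (hi : ∀ k, i ≤ N k + 1)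
    (σ : Shape T i n) (y : Fin n → α) :
    Def Language.graph (fun k => Model T (R k) (ω k)) fun _ a =>
      Model.shape i (fun s => a (y s)) = σ := by
  refine Def.congr (.and (.forall_finite fun s => kind_eq hG hi (σ.1 s) (y s))
    (.forall_finite fun s => .forall_finite fun t =>
      .and ((Def.eq (y s) (y t)).decide_eq (σ.2 s t).1)
      (.and ((part_eq hG (y s) (y t)).decide_eq (σ.2 s t).2.1)
        ((Def.edge (y s) (y t)).decide_eq (σ.2 s t).2.2)))) fun k a => ?_
  simp only [Model.shape, Prod.ext_iff, funext_iff]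

end Def

end ModelDefinability

namespace Model

variable {N S B : ℕ} {T : ℕ → ℕ} {R R' : Record N S}
  {ω : Label N S × Fin B → Label N S × Fin B → Bool}

theorem kind_colour_eq_of_view {i : ℕ} {x : Model T R ω} {y : Model T R' ω}
    (h : x.view i = y.view i) :
    x.kind i = y.kind i ∧ ∀ p, x.colour i p = y.colour i p := by
  cases x with
  | chain c =>
    rw [eq_chain_of_view h.symm]
    exact ⟨rfl, fun _ => rfl⟩
  | vert l hl b =>
    obtain ⟨l', hl', b', rfl, hc, h₁, h₂⟩ := exists_vert_of_view h rfl
    by_cases hi : l.part.1 < i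
    · obtain rfl := h₁ hi
      exact ⟨rfl, fun _ => rfl⟩
    · have hi' := (h₂ (not_lt.1 hi)).not_gt
      refine ⟨by simp [kind, hi, hi'], fun p => ?_⟩
      simp only [colour, hi, hi', if_false, hc]
      split <;> split <;> rfl

/-- This carries a code from the full model to the partial one, where the record was defined. -/
theorem code_eq_of_alike {i n : ℕ} {x : Fin n → Model T R ω} {y : Fin n → Model T R' ω}
    (h : Alike i x y) : code i x = code i y := by
  have hshape : shape i x = shape i y := by
    refine Prod.ext (funext fun s => (kind_colour_eq_of_view (h.1 s)).1)
      (funext fun s => funext fun t => ?_)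
    obtain ⟨h₁, h₂, h₃⟩ := h.2 s t
    simp only [shape, Prod.mk.injEq, decide_eq_decide]
    exact ⟨h₁, h₂, h₃⟩
  funext p
  simp only [code, hshape]
  split_ifs
  · cases position n p with
    | none => rfl
    | some sq => exact (kind_colour_eq_of_view (h.1 sq.1)).2 sq.2
  · rfl

/-- A tuple is recorded in part `i` if and only if it is the tuple of colours of a longest
transitive tournament in this part. -/
theorem record_iff (hG : Good T R ω) {i : ℕ} (hi : i ≤ N) {u : Fin S → Fin (N + 1)}
    (hu : ∀ p : Fin S, 2 * T i ≤ p.1 → u p = 0) :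
    R i u ↔ ∃ x : Fin (2 * T i) → Model T R ω, Tour x ∧ (∀ p, InPart T i (x p)) ∧
      ∀ p : Fin (2 * T i), ∀ hp : p.1 < S, Edge (x p) (chain (u ⟨p, hp⟩)) := by
  let j : Fin (N + 1) := ⟨i, Nat.lt_succ_of_le hi⟩
  have h3 := hG.three_le i
  have hS : 2 * T i ≤ S := two_mul_le hG j
  simp only [inPart_iff hG]
  constructor
  · intro hr
    obtain ⟨z, -⟩ := hG.universal ∅ (by simp) (fun _ => true) (fun _ => true)
      (Label.special j (fun _ => 0) ⟨0, by omega⟩)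
    obtain ⟨b, -, hx⟩ := exists_tour (j := j) hG hr ⟨0, by simp only [j]; omega⟩ z
    exact ⟨_, hx, fun p => rfl, fun p hp => rfl⟩
  · rintro ⟨x, hx, hp, hc⟩
    obtain ⟨u', hu', h⟩ := Tour.exists_record (j := j) hG hx hp
    have : u = u' := by
      funext p
      by_cases hlt : p.1 < 2 * T i
      · have hE := hc ⟨p, hlt⟩ p.2
        obtain ⟨hl, b, he⟩ := h ⟨p, hlt⟩
        rw [he, edge_vert_chain] at hE
        exact hE.symm
      · rw [hu p (not_lt.1 hlt), hG.support _ _ hu' p (not_lt.1 hlt)]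
    rwa [this]

end Model

theorem PebbleSystem.exists_rel {L : FirstOrder.Language} {M M' : Type*} [L.Structure M]
    [L.Structure M'] {K : ℕ} (P : PebbleSystem L M M' K)
    (h : ∀ (a : Fin 0 → M) (b : Fin 0 → M'), P.rel a b) {m : ℕ} (hm : m ≤ K) (a : Fin m → M) :
    ∃ b : Fin m → M', P.rel a b := by
  induction m with
  | zero => exact ⟨fun p => p.elim0, h _ _⟩
  | succ m ih =>
    obtain ⟨b, hb⟩ := ih (by omega) (Fin.init a)
    obtain ⟨y, hy⟩ := P.forth hm hb (a (Fin.last m))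
    rw [Fin.snoc_init_self] at hy
    exact ⟨_, hy⟩

/-! ### The recursive definition of the records. -/

section Records

variable {T n : ℕ → ℕ} (φ : ∀ i, Fml Language.graph [] (n i)) {N S B : ℕ}
  (ω : Label N S × Fin B → Label N S × Fin B → Bool)

variable (T) in
/-- The records of the parts before number `i`; the other records are trivial. -/
noncomputable def partialRecord : ℕ → Record N S
  | 0 => fun _ u => u = fun _ => 0
  | i + 1 => fun j u =>
      -- The formula is evaluated in the model with the records of the parts before `i` only. The
      -- zero tuple guarantees that the part contains a longest tournament.
      if j = i then (u = fun _ => 0) ∨ ∃ y : Fin (n i) → Model T (partialRecord i) ω,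
        Model.code i y = u ∧ (φ i).Realize RelEnv.nil y
      else partialRecord i j u

variable (T) in
/-- Part `i` records the codes of the tuples that satisfy the formula number `i`. -/
noncomputable def fullRecord : Record N S := fun j => partialRecord T φ ω (j + 1) j

theorem partialRecord_of_lt {i j : ℕ} (h : j < i) :
    partialRecord T φ ω i j = fullRecord T φ ω j := by
  induction i with
  | zero => omega
  | succ i ih =>
    rcases eq_or_ne j i with rfl | hne
    · rfl
    · rw [← ih (by omega)]
      funext u
      rw [partialRecord]
      exact if_neg hne

theorem partialRecord_of_le {i j : ℕ} (h : i ≤ j) :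
    partialRecord T φ ω i j = fun u => u = fun _ => 0 := by
  induction i with
  | zero => rfl
  | succ i ih =>
    rw [← ih (by omega)]
    funext u
    rw [partialRecord]
    exact if_neg (by omega)

theorem fullRecord_iff (i : ℕ) (u : Fin S → Fin (N + 1)) :
    fullRecord T φ ω i u ↔ (u = fun _ => 0) ∨ ∃ y : Fin (n i) → Model T (partialRecord T φ ω i) ω,
      Model.code i y = u ∧ (φ i).Realize RelEnv.nil y := by
  rw [fullRecord, partialRecord]
  exact iff_of_eq (if_pos rfl)

theorem good_fullRecord (hω : IsUniversal S ω) (h3 : ∀ j, 3 ≤ T j) (hT : StrictMono T)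
    (hS : 2 * T N ≤ S) : Good T (fullRecord T φ ω) ω where
  universal := hω
  three_le := h3
  strictMono := hT
  le := hS
  zero j := (fullRecord_iff φ ω j _).2 (.inl rfl)
  support j u hu p hp := by
    rcases (fullRecord_iff φ ω j u).1 hu with rfl | ⟨y, rfl, -⟩
    · rfl
    · rw [Model.code, if_neg hp.not_gt]

variable {φ ω} in
theorem Good.partialRecord (h : Good T (fullRecord T φ ω) ω) (i : ℕ) :
    Good T (partialRecord T φ ω i) ω where
  universal := h.universal
  three_le := h.three_le
  strictMono := h.strictMono
  le := h.le
  zero j := by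
    rcases lt_or_ge j i with hj | hj
    · rw [partialRecord_of_lt φ ω hj]
      exact h.zero j
    · rw [partialRecord_of_le φ ω hj]
  support j u hu := by
    rcases lt_or_ge j i with hj | hj
    · rw [partialRecord_of_lt φ ω hj] at hu
      exact h.support j u hu
    · rw [partialRecord_of_le φ ω hj] at hu
      subst hu
      exact fun _ _ => rfl

/-- The truth of the formula number `i` is recorded in part `i`. -/
theorem realize_iff_record (hG : Good T (fullRecord T φ ω) ω) {i : ℕ}
    (hw : (φ i).width ≤ T i) (hn : n i ≤ T i) (hi : i + T i ≤ N + 1)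
    (hN : Fintype.card (Shape T i (n i)) ≤ N)
    (hpair : ∀ s < n i, ∀ q, (q = 0 ∨ ∃ j < i, q < 2 * T j) → Nat.pair (s + 1) q < 2 * T i)
    (y : Fin (n i) → Model T (fullRecord T φ ω) ω) :
    (φ i).Realize RelEnv.nil y ↔ fullRecord T φ ω i (Model.code i y) := by
  have h3 := hG.three_le i
  have hiN : i ≤ N := by omega
  have hTS : ∀ j ≤ N, 2 * T j ≤ S := fun j hj => Model.two_mul_le hG ⟨j, Nat.lt_succ_of_le hj⟩
  -- The full and the partial model agree in the parts before `i`, and `T i` pebbles cannot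
  -- distinguish the records of the others.
  let P : PebbleSystem Language.graph (Model T (fullRecord T φ ω) ω)
      (Model T (partialRecord T φ ω i) ω) (T i) :=
    Model.pebbleSystem (i := i) hG.universal (by have := hTS i hiN; omega)
      (fun j hj u => by rw [partialRecord_of_lt φ ω hj])
      (fun j hij hj => ⟨hG.strictMono.monotone hij, by have := hTS j hj; omega⟩) hi
  have key : ∀ y', Model.Alike i y y' →
      ((φ i).Realize RelEnv.nil y ↔ (φ i).Realize RelEnv.nil y') := fun y' h =>
    P.realize_iff (φ i) hw _ _ _ _ h fun j => j.elim0
  rw [fullRecord_iff]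
  constructor
  · intro hy
    obtain ⟨y', h⟩ := P.exists_rel (fun a b => ⟨fun s => s.elim0, fun s => s.elim0⟩) hn y
    exact .inr ⟨y', (Model.code_eq_of_alike h).symm, (key y' h).1 hy⟩
  · rintro (h0 | ⟨y', hc, hy'⟩)
    · exact absurd h0 (Model.code_ne_zero hG hiN hN y)
    · exact (key y' (Model.alike_of_code_eq hG (hG.partialRecord i) hiN hN hpair hc.symm)).2 hy'

end Records

/-! ### The sequence of digraphs and the first-order equivalents. -/

section Construction

/-- The numbers of labels grow fast enough for the formulas `φ i`. -/
structure Fast (T n : ℕ → ℕ) (φ : ∀ i, Fml Language.graph [] (n i)) : Prop where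
  three_le : ∀ i, 3 ≤ T i
  strictMono : StrictMono T
  width_le : ∀ i, (φ i).width ≤ T i
  arity_le : ∀ i, n i ≤ T i
  pair_lt : ∀ i, ∀ s < n i, ∀ q, (q = 0 ∨ ∃ j < i, q < 2 * T j) → Nat.pair (s + 1) q < 2 * T i

theorem exists_fast (n : ℕ → ℕ) (φ : ∀ i, Fml Language.graph [] (n i)) : ∃ T, Fast T n φ := by
  -- The summands of `c i m` are the lower bounds required of `T i`; here `m` stands for a bound on
  -- `2 * T j` for `j < i`, so that the last summand exceeds all positions used in codes.
  let c : ℕ → ℕ → ℕ := fun i m => 3 + (φ i).width + n i + Nat.pair (n i + 1) (m + 1)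
  let T : ℕ → ℕ := fun i => Nat.rec (c 0 0) (fun i t => t + c (i + 1) (2 * t)) i
  have hsucc : ∀ i, T (i + 1) = T i + c (i + 1) (2 * T i) := fun i => rfl
  have hmono : StrictMono T := strictMono_nat_of_lt_succ fun i => by
    rw [hsucc]
    simp only [c]
    omega
  have hc : ∀ i, ∃ m, c i m ≤ T i ∧ ∀ j < i, 2 * T j ≤ m := by
    intro i
    cases i with
    | zero => exact ⟨0, le_rfl, by simp⟩
    | succ i =>
      refine ⟨2 * T i, by rw [hsucc]; omega, fun j hj => ?_⟩
      have := hmono.monotone (Nat.lt_succ_iff.1 hj)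
      omega
  refine ⟨T, ⟨fun i => ?_, hmono, fun i => ?_, fun i => ?_, fun i s hs q hq => ?_⟩⟩
  · obtain ⟨m, hm, -⟩ := hc i
    simp only [c] at hm
    omega
  · obtain ⟨m, hm, -⟩ := hc i
    simp only [c] at hm
    omega
  · obtain ⟨m, hm, -⟩ := hc i
    simp only [c] at hm
    omega
  · obtain ⟨m, hm, hj⟩ := hc i
    have hqm : q < m + 1 := by
      rcases hq with rfl | ⟨j, hji, hq⟩
      · omega
      · have := hj j hji
        omega
    have h₁ := Nat.pair_lt_pair_left q (Nat.succ_lt_succ hs)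
    have h₂ := Nat.pair_lt_pair_right (n i + 1) hqm
    simp only [c] at hm
    simp only [Nat.succ_eq_add_one] at h₁
    omega

/-- The number of vertices with each label in the model number `N`. -/
noncomputable def multiplicity (T : ℕ → ℕ) (N : ℕ) : ℕ :=
  (exists_isUniversal (Label N (2 * T N)) (2 * T N)).choose

/-- The universal relation of the model number `N`. -/
noncomputable def universalRel (T : ℕ → ℕ) (N : ℕ) :
    Label N (2 * T N) × Fin (multiplicity T N) → Label N (2 * T N) × Fin (multiplicity T N) →
      Bool :=
  (exists_isUniversal (Label N (2 * T N)) (2 * T N)).choose_spec.choose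

theorem isUniversal_universalRel (T : ℕ → ℕ) (N : ℕ) :
    IsUniversal (2 * T N) (universalRel T N) :=
  (exists_isUniversal (Label N (2 * T N)) (2 * T N)).choose_spec.choose_spec

variable {T n : ℕ → ℕ}

variable (T) in
/-- The digraph number `N` of the sequence. -/
noncomputable def digraph (φ : ∀ i, Fml Language.graph [] (n i)) (N : ℕ) : FinDigraph where
  carrier := Model T (fullRecord T φ (universalRel T N)) (universalRel T N)
  str := inferInstance
  fin := inferInstance
  nonempty := inferInstance

variable {φ : ∀ i, Fml Language.graph [] (n i)}

theorem Fast.good (hT : Fast T n φ) (N : ℕ) :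
    Good T (fullRecord T φ (universalRel T N)) (universalRel T N) :=
  good_fullRecord φ _ (isUniversal_universalRel T N) hT.three_le hT.strictMono le_rfl

theorem Fast.definable (hT : Fast T n φ) (i : ℕ) :
    Def Language.graph (fun N => (digraph T φ N).carrier) fun _ a =>
      (φ i).Realize RelEnv.nil a := by
  -- From `N₀` on there are enough late parts for the game with `T i` pebbles, and enough colours to
  -- number the shapes.
  set N₀ := i + T i + Fintype.card (Shape T i (n i)) with hN₀
  refine definable_of_eventually (digraph T φ) (φ i) N₀ ?_
  change Def Language.graph (fun N : {N // N₀ ≤ N} =>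
    Model T (fullRecord T φ (universalRel T N)) (universalRel T N)) fun _ a =>
      (φ i).Realize RelEnv.nil a
  have hG : ∀ N : {N // N₀ ≤ N},
      Good T (fullRecord T φ (universalRel T N)) (universalRel T N) := fun N => hT.good N
  have hi : ∀ N : {N // N₀ ≤ N}, i ≤ N.1 + 1 := fun N => by
    have := N.2
    omega
  have hle : ∀ (σ : Shape T i (n i)) (N : {N // N₀ ≤ N}), shapeNumber σ ≤ N.1 := fun σ N => by
    have := N.2
    have := shapeNumber_le σ
    omega
  -- The formula first guesses the shape. This fixes the kinds of the entries, hence how to define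
  -- their colours, and it remains to ask for a longest tournament of part `i` that spells the code.
  have hdef : Def Language.graph (fun N : {N // N₀ ≤ N} =>
      Model T (fullRecord T φ (universalRel T N)) (universalRel T N)) fun N y =>
      ∃ σ : Shape T i (n i), Model.shape i (fun s => y s) = σ ∧
        ∃ x : Fin (2 * T i) → Model T (fullRecord T φ (universalRel T N)) (universalRel T N),
          Tour (fun p => x p) ∧ (∀ p, InPart T i (x p)) ∧ ∀ p, ∃ c, Edge (x p) c ∧
            match position (n i) p.1 with
            | some (s, q) => (y s).kind i = σ.1 s ∧ c = .chain ((y s).colour i q)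
            | none => c = .chain (Fin.ofNat (N.1 + 1) (shapeNumber σ)) := by
    refine .exists_finite fun σ => .and (.shape_eq hG hi σ _) (.exists_tuple (.and (.tour _)
      (.and (.forall_finite fun p => .inPart _ _ _) (.forall_finite fun p => .exists_elem
        (.and (.edge _ _) ?_)))))
    cases hpos : position (n i) p.1 with
    | none => exact .eq_chain _ (hle σ) _
    | some sq => exact .kind_and_colour hG hi _ _ _ _
  refine hdef.congr fun N y => ?_
  have hN := N.2
  have hS : 2 * T i ≤ 2 * T N.1 :=
    Nat.mul_le_mul_left 2 (hT.strictMono.monotone (by omega))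
  rw [realize_iff_record φ _ (hG N) (hT.width_le i) (hT.arity_le i) (by omega) (by omega)
    (hT.pair_lt i), Model.record_iff (u := Model.code i y) (hG N) (by omega)
      fun p hp => if_neg hp.not_gt]
  simp only [exists_eq_left']
  refine exists_congr fun x => and_congr_right fun _ => and_congr_right fun _ =>
    forall_congr' fun p => ?_
  have hp : p.1 < 2 * T N.1 := p.2.trans_le hS
  simp only [hp, forall_true_left, Model.code, p.2, if_true]
  cases position (n i) p.1 with
  | none => simp
  | some sq => simp [Model.shape]

end Construction

/-! ### An induction of unbounded depth along the chain. -/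

section UnboundedInduction

/-- `P(x)` if `x` has a loop and all its predecessors `z ≠ x` with a loop satisfy `P(z)`. -/
def chainFml : Fml Language.graph [1] (0 + 1) :=
  .and (.rel adj ![.var 0, .var 0])
    (.neg (.ex (.and (.rel adj ![.var 1, .var 1]) (.and (.rel adj ![.var 1, .var 0])
      (.and (.neg (.equal (.var 1) (.var 0))) (.neg (.relVar (0 : Fin 1) fun _ => .var 1)))))))

theorem mem_operator_chainFml {M : Type*} [Language.graph.Structure M] (a : Fin 0 → M)
    (P : Set (Fin 1 → M)) (x : Fin 1 → M) :
    x ∈ chainFml.operator a P ↔ Edge (x 0) (x 0) ∧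
      ∀ z, Edge z z → Edge z (x 0) → z ≠ x 0 → (fun _ => z) ∈ P := by
  have hx : (Fin.append a x : Fin (0 + 1) → M) 0 = x 0 := Fin.append_right a x 0
  have hs : ∀ z, (Fin.snoc (Fin.append a x) z : Fin (0 + 1 + 1) → M) 1 = z := fun z =>
    Fin.snoc_last (α := fun _ => M) z _
  have hs' : ∀ z, (Fin.snoc (Fin.append a x) z : Fin (0 + 1 + 1) → M) 0 = x 0 := fun z =>
    (Fin.snoc_castSucc (α := fun _ => M) z _ 0).trans hx
  have hv : ∀ {m : ℕ} (b : Fin m → M) (i j : Fin m),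
      (RelMap adj fun l => Term.realize b
        ((![Term.var i, Term.var j] : Fin 2 → Language.graph.Term (Fin m)) l)) ↔
          Edge (b i) (b j) :=
    fun b i j => iff_of_eq (congrArg _ (by ext l; fin_cases l <;> rfl))
  change Fml.Realize _ _ _ ↔ _
  simp only [chainFml, Fml.Realize, hv, Term.realize_var, hx, hs, hs']
  push Not
  rfl

theorem stage_chainFml {N S B : ℕ} {T : ℕ → ℕ} {R : Record N S}
    {ω : Label N S × Fin B → Label N S × Fin B → Bool} (a : Fin 0 → Model T R ω) (k : ℕ) :
    stage (chainFml.operator a) k = {x | ∃ c : Fin (N + 1), c.1 < k ∧ x 0 = .chain c} := by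
  induction k with
  | zero => simp [stage]
  | succ k ih =>
    ext x
    rw [stage, mem_operator_chainFml, ih]
    simp only [Set.mem_ofPred_eq]
    constructor
    · rintro ⟨hx, h⟩
      cases hx0 : x 0 with
      | vert l hl b => simp [hx0, Model.edge_self_iff] at hx
      | chain c =>
        refine ⟨c, ?_, rfl⟩
        by_contra! hlt
        obtain ⟨c', hc', he⟩ := h (.chain ⟨k, by omega⟩) (by simp)
          (by rw [hx0, Model.edge_chain_chain, Fin.le_def]; simp only; omega)
          (by rw [hx0, Ne, Model.chain.injEq, Fin.ext_iff]; simp only; omega)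
        rw [Model.chain.injEq] at he
        subst he
        exact lt_irrefl _ hc'
    · rintro ⟨c, hc, hx⟩
      rw [hx]
      refine ⟨by simp, fun z hz hzc hne => ?_⟩
      cases z with
      | vert l hl b => simp [Model.edge_self_iff] at hz
      | chain c' =>
        refine ⟨c', ?_, rfl⟩
        rw [Model.edge_chain_chain, Fin.le_def] at hzc
        have : c'.1 ≠ c.1 := fun h => hne (by rw [Fin.ext h])
        omega

/-- The digraph number `j` has `j + 1` colours, and the last one enters only at stage `j + 1`. -/
theorem not_inductionsBounded {T n : ℕ → ℕ} (φ : ∀ i, Fml Language.graph [] (n i)) :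
    ¬ InductionsBounded (isoClass (digraph T φ)) := by
  intro h
  obtain ⟨j, hj⟩ := h 0 1 chainFml (by simp [chainFml, Fml.IsFO])
    (by simp [chainFml, Fml.Polarity])
  have hj := hj (digraph T φ j) ⟨j, ⟨Language.Equiv.refl _ _⟩⟩ fun s => s.elim0
  let x : Fin 1 → Model T (fullRecord T φ (universalRel T j)) (universalRel T j) :=
    fun _ => .chain ⟨j, by omega⟩
  have hx : x ∈ stage (chainFml.operator (M := Model T (fullRecord T φ (universalRel T j))
      (universalRel T j)) fun s => s.elim0) j := by
    refine Eq.mpr (congrArg (fun X => x ∈ X) hj) (Set.mem_iUnion.2 ⟨j + 1, ?_⟩)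
    change x ∈ stage (chainFml.operator (M := Model T (fullRecord T φ (universalRel T j))
      (universalRel T j)) fun s => s.elim0) (j + 1)
    rw [stage_chainFml]
    exact ⟨⟨j, by omega⟩, by simp, rfl⟩
  rw [stage_chainFml] at hx
  obtain ⟨c, hc, he⟩ := hx
  simp only [x, Model.chain.injEq] at he
  subst he
  exact lt_irrefl _ hc

end UnboundedInduction

theorem exists_enumeration : ∃ (n : ℕ → ℕ) (φ : ∀ i, Fml Language.graph [] (n i)),
    ∀ m (ψ : Fml Language.graph [] m),
      ∃ i, (⟨n i, φ i⟩ : Σ m, Fml Language.graph [] m) = ⟨m, ψ⟩ := by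
  have : Nonempty (Σ m, Fml Language.graph [] m) := ⟨⟨1, .equal (.var 0) (.var 0)⟩⟩
  obtain ⟨f, hf⟩ := exists_surjective_nat (Σ m, Fml Language.graph [] m)
  exact ⟨fun i => (f i).1, fun i => (f i).2, fun m ψ => hf ⟨m, ψ⟩⟩

end McColm

theorem mainTheorem1 :
    ∃ G : ℕ → McColm.FinDigraph,
      ¬ McColm.InductionsBounded (McColm.isoClass G) ∧
      McColm.LFPCollapsesToFO (McColm.isoClass G) := by
  obtain ⟨n, φ, hφ⟩ := McColm.exists_enumeration
  obtain ⟨T, hT⟩ := McColm.exists_fast n φ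
  refine ⟨McColm.digraph T φ, McColm.not_inductionsBounded φ, fun m χ _ => ?_⟩
  obtain ⟨i, hi⟩ := hφ m χ
  cases hi
  obtain ⟨ψ, hψ⟩ := hT.definable i
  refine ⟨ψ, ?_⟩
  rintro M ⟨N, ⟨f⟩⟩ a
  exact (McColm.Fml.realize_equiv f _ a).trans ((hψ N (f ∘ a)).trans
    (FirstOrder.Language.StrongHomClass.realize_formula f ψ))
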